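/- **Setting.** Let $K,T\ge 1$ be integers. For each time $t\in\{1,\dots,T\}$ and arm $k\in\mathcal K=\{1,\dots,K\}$ let $X_{k,t}$ be a random reward with law $f_{k,t}$ supported in $[0,1]$; the reward vectors $(X_{k,t})_{k}$ are independent for different $t$. Let $M=1+\#\{1\le t\le T-1: f_{k,t}\ne f_{k,t+1}\text{ for some }k\}$ be the number of segments, $\nu_1<\dots<\nu_{M-1}$ the change points (the times $t$ counted in $M$), $\nu_0=0$, $\nu_M=T$. Write $\mu^{(i)}_k$ for the mean of arm $k$ on the $i$-th segment $\{\nu_{i-1}+1,\dots,\nu_i\}$ and $\Delta^{(i)}_k=\max_{j}\mu^{(i)}_{j}-\mu^{(i)}_k$. If $A_t$ is the arm played at time $t$, the dynamic regret is $\mathcal R(T)=\sum_{t=1}^T\max_k\mathbb E[X_{k,t}]-\mathbb E\big[\sum_{t=1}^T X_{A_t,t}\big]$. **Algorithm 1 (UCB with diminishing exploration and a change detector).** The parameters are $\alpha>0$, an integer $w\ge0$ and a change detector $\mathrm{CD}$, that is, an arbitrary measurable rule which from the arms played and the rewards observed so far (and possibly internal randomization independent of all the rewards) answers "true" or "false".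 Initialize $\tau\leftarrow0$, $u\leftarrow\lceil(\alpha-\frac{K}{4\alpha})^2\rceil$. In round $t=1,\dots,T$: 1. If $u\le t-\tau<u+K$, play arm $A_t=(t-\tau)-u+1$. Otherwise, if $t-\tau=u+K$, first set $u\leftarrow\big\lceil u+\frac K\alpha\sqrt u+\frac{K^2}{4\alpha^2}\big\rceil$; then (whether or not $u$ was updated) play an arm $A_t$ that maximizes $\mathrm{UCB}_k=\hat\mu_k+\sqrt{2\log(t-\tau)/n_k}$, where $n_k$ and $\hat\mu_k$ are the number and the average of the samples of arm $k$ since the last alarm ($\mathrm{UCB}_k=+\infty$ if $n_k=0$; ties are broken by a fixed rule, depending only on the set of maximizers). 2. Observe $X_{A_t,t}$. If arm $A_t$ now has at least $w$ samples since the last alarm and $\mathrm{CD}$ answers "true", an alarm is raised: $\tau\leftarrow t$, all samples are discarded ($n_k\leftarrow 0$), and $u$ is reset, either to $1$ or to $\lceil(\alpha-\frac{K}{4\alpha})^2\rceil$ (always to the same one of the two; the theorem holds for both variants). Let $\tau_0=0$ and let $\tau_i$ be the time of the $i$-th alarm ($\tau_i=\infty$ if there are fewer than $i$ alarms up to time $T$).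 Let $F_i=\{\tau_i<\nu_i\}$ for $0\le i\le M$ (so $F_0=\emptyset$), and, for given integers $h_i\ge0$, let $D_i=\{\tau_i\le\nu_i+h_i\}$ for $1\le i\le M-2$, $D_0=\{\tau_0=0\}$, and $D_{M-1}=\{\tau_{M-1}\le T\}$. Complements are denoted by a bar and intersections by juxtaposition. **Theorem.** For every $\alpha>0$, every $w$, every change detector and all integers $h_i\ge0$, $$\mathcal R(T)\le\sum_{i=1}^M\tilde C_i+2\alpha\sqrt{MT}+\sum_{i=1}^{M-1}\mathbb E\big[\tau_i-\nu_i\,\big|\,D_i\overline F_iD_{i-1}\overline F_{i-1}\big]+T\sum_{i=1}^M\mathbb P\big(F_i\,\big|\,\overline F_{i-1}D_{i-1}\big)+T\sum_{i=1}^{M-1}\mathbb P\big(\overline D_i\,\big|\,\overline F_i\overline F_{i-1}D_{i-1}\big),$$ where $$\tilde C_i=8\sum_{k:\,\Delta^{(i)}_k>0}\frac{\log T}{\Delta^{(i)}_k}+\Big(\frac52+\frac{\pi^2}3+K\Big)\sum_{k=1}^K\Delta^{(i)}_k .$$ Conditional probabilities and expectations given an event of probability zero are read as $0$. -/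

import Mathlib

open MeasureTheory ProbabilityTheory

namespace DimExp

noncomputable section

/- ### The piecewise-stationary environment

Time steps are `1, …, T`; `f t k` is the reward law of arm `k` at time `t`. Arms are `Fin K`, so
that arm number `a` (for `1 ≤ a ≤ K`) is the element `a - 1` of `Fin K`. -/

/-- Some arm changes its reward law between the times `t` and `t + 1` of the horizon. -/
def IsChange {K : ℕ} (f : ℕ → Fin K → Measure ℝ) (T t : ℕ) : Prop :=
  1 ≤ t ∧ t + 1 ≤ T ∧ ∃ k, f t k ≠ f (t + 1) k

open Classical in
/-- The number `M` of stationary segments. -/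
def numSegments {K : ℕ} (f : ℕ → Fin K → Measure ℝ) (T : ℕ) : ℕ :=
  1 + ((Finset.Icc 1 (T - 1)).filter (fun t => IsChange f T t)).card

/-- `ν 0 = 0`, `ν i` is the `i`-th change point for `1 ≤ i ≤ M - 1`, and `ν M = T`. -/
def changeTime {K : ℕ} (f : ℕ → Fin K → Measure ℝ) (T i : ℕ) : ℕ :=
  if i = 0 then 0
  else if i < numSegments f T then Nat.nth (IsChange f T) (i - 1)
  else T

/-- The mean reward of arm `k` in segment `i`, `1 ≤ i ≤ M`; that segment is
`{ν (i-1) + 1, …, ν i}`, and the laws are constant on it. -/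
def segMean {K : ℕ} (f : ℕ → Fin K → Measure ℝ) (T i : ℕ) (k : Fin K) : ℝ :=
  ∫ x, x ∂(f (changeTime f T (i - 1) + 1) k)

/-- The gap of arm `k` in segment `i`. -/
def gap {K : ℕ} (f : ℕ → Fin K → Measure ℝ) (T i : ℕ) (k : Fin K) : ℝ :=
  (⨆ j, segMean f T i j) - segMean f T i k

open Classical in
/-- The UCB constant of segment `i`. -/
def ucbConst {K : ℕ} (f : ℕ → Fin K → Measure ℝ) (T i : ℕ) : ℝ :=
  8 * ∑ k with 0 < gap f T i k, Real.log T / gap f T i k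
    + (5 / 2 + Real.pi ^ 2 / 3 + K) * ∑ k, gap f T i k

/- ### UCB with diminishing exploration and a change detector -/

/-- The initial value `⌈(α - K / (4 α))²⌉` of `u`. -/
def firstStart (K : ℕ) (α : ℝ) : ℕ := ⌈(α - K / (4 * α)) ^ 2⌉₊

/-- The update `u ↦ ⌈u + (K / α) √u + K² / (4 α²)⌉`. -/
def nextStart (K : ℕ) (α : ℝ) (u : ℕ) : ℕ :=
  ⌈(u : ℝ) + K / α * Real.sqrt u + (K : ℝ) ^ 2 / (4 * α ^ 2)⌉₊

/-- The inputs of the algorithm. -/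
structure Config (K : ℕ) (Ξ : Type*) where
  /-- the exploration parameter -/
  α : ℝ
  /-- the value given to `u` after an alarm -/
  restart : ℕ
  /-- the number of samples of the arm just played from which on the detector is consulted -/
  w : ℕ
  /-- the choice of one arm among the maximizers of the UCB index -/
  tie : Finset (Fin K) → Fin K
  /-- the change detector: `cd ξ t τ a y` is its answer after round `t`, when its internal
  randomization is `ξ`, the last alarm was at `τ`, and `a s`, `y s` are the arm played and the
  reward received in round `s` for `1 ≤ s ≤ t` (the entries for other `s` carry no information) -/
  cd : Ξ → ℕ → ℕ → (ℕ → Fin K) → (ℕ → ℝ) → Prop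

/-- The memory of the algorithm between two rounds: the time `tau` of the last alarm (`0` if there
was none), the start `u` of the exploration session (relative to `tau`), and the log of the arms
played and of the rewards received. The samples `Z` of an arm are the logged rewards of that arm
after `tau`. -/
structure State (K : ℕ) where
  tau : ℕ
  u : ℕ
  arm : ℕ → Fin K
  rew : ℕ → ℝ

/-- `n_k`: the number of plays of arm `k` after the last alarm and up to time `t`. -/
def State.count {K : ℕ} (s : State K) (t : ℕ) (k : Fin K) : ℕ :=
  ((Finset.Ioc s.tau t).filter (fun r => s.arm r = k)).card

/-- The sum of the rewards of these plays. -/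
def State.total {K : ℕ} (s : State K) (t : ℕ) (k : Fin K) : ℝ :=
  ∑ r ∈ (Finset.Ioc s.tau t).filter (fun r => s.arm r = k), s.rew r

/-- The UCB index of arm `k` in round `t`; it is `+∞` for an arm without samples. -/
def State.index {K : ℕ} (s : State K) (t : ℕ) (k : Fin K) : EReal :=
  if s.count (t - 1) k = 0 then ⊤
  else ((s.total (t - 1) k / s.count (t - 1) k
    + Real.sqrt (2 * Real.log ((t - s.tau : ℕ) : ℝ) / s.count (t - 1) k) : ℝ) : EReal)

open Classical in
/-- The arms that maximize the UCB index in round `t`. -/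
def State.maximizers {K : ℕ} (s : State K) (t : ℕ) : Finset (Fin K) :=
  Finset.univ.filter (fun k => ∀ j, s.index t j ≤ s.index t k)

/-- The first half of round `t`: the pair of the arm to play and the (possibly updated) `u`. -/
def State.decide {K : ℕ} {Ξ : Type*} (c : Config K Ξ) (s : State K) (t : ℕ) : Fin K × ℕ :=
  if h : s.u ≤ t - s.tau ∧ t - s.tau < s.u + K then
    (⟨(t - s.tau) - s.u, by omega⟩, s.u)
  else
    (c.tie (s.maximizers t),
      if t - s.tau = s.u + K then nextStart K c.α s.u else s.u)

/-- The state after the arm of round `t` has been played and its reward recorded, where `x k` is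
the reward that arm `k` would give. -/
def State.play {K : ℕ} {Ξ : Type*} (c : Config K Ξ) (s : State K) (t : ℕ) (x : Fin K → ℝ) :
    State K where
  tau := s.tau
  u := (s.decide c t).2
  arm := Function.update s.arm t (s.decide c t).1
  rew := Function.update s.rew t (x (s.decide c t).1)

open Classical in
/-- The whole round `t`: play, then restart if the detector is consulted and answers "true". -/
def State.step {K : ℕ} {Ξ : Type*} (c : Config K Ξ) (ξ : Ξ) (s : State K) (t : ℕ)
    (x : Fin K → ℝ) : State K :=
  let s' := s.play c t x
  if c.w ≤ s'.count t (s'.arm t) ∧ c.cd ξ t s'.tau s'.arm s'.rew then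
    { s' with tau := t, u := c.restart }
  else s'

/-- The state after round `t`, when the reward of arm `k` at time `s` is `x s k`. -/
def run {K : ℕ} [NeZero K] {Ξ : Type*} (c : Config K Ξ) (ξ : Ξ) (x : ℕ → Fin K → ℝ) :
    ℕ → State K
  | 0 => { tau := 0, u := firstStart K c.α, arm := fun _ => 0, rew := fun _ => 0 }
  | t + 1 => (run c ξ x t).step c ξ (t + 1) (x (t + 1))

/-- The arm `A_t` played in round `t ≥ 1`. -/
def armAt {K : ℕ} [NeZero K] {Ξ : Type*} (c : Config K Ξ) (ξ : Ξ) (x : ℕ → Fin K → ℝ) (t : ℕ) :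
    Fin K :=
  (run c ξ x t).arm t

/-- `τ_i`: the time of the `i`-th alarm raised during `1, …, T`, with `τ_0 = 0`; it is `⊤` if
there are fewer than `i` alarms. -/
def alarmTime {K : ℕ} [NeZero K] {Ξ : Type*} (c : Config K Ξ) (ξ : Ξ) (x : ℕ → Fin K → ℝ)
    (T : ℕ) : ℕ → ℕ∞
  | 0 => 0
  | i + 1 => sInf {n : ℕ∞ | ∃ t : ℕ, n = t ∧ t ≤ T ∧ alarmTime c ξ x T i < t ∧
      (run c ξ x t).tau = t}

/- ### Regret and detection events -/

section Events

variable {K : ℕ} [NeZero K] {Ω Ξ : Type*}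

/-- The dynamic regret over `1, …, T`. -/
def regret [MeasurableSpace Ω] (P : Measure Ω) (X : ℕ → Fin K → Ω → ℝ) (ξ : Ω → Ξ)
    (c : Config K Ξ) (T : ℕ) : ℝ :=
  ∑ t ∈ Finset.Icc 1 T, (⨆ k, ∫ ω, X t k ω ∂P)
    - ∫ ω, ∑ t ∈ Finset.Icc 1 T, X t (armAt c (ξ ω) (fun s k => X s k ω) t) ω ∂P

/-- `τ_i` as a random variable. -/
def alarm (X : ℕ → Fin K → Ω → ℝ) (ξ : Ω → Ξ) (c : Config K Ξ) (T i : ℕ) (ω : Ω) : ℕ∞ :=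
  alarmTime c (ξ ω) (fun s k => X s k ω) T i

/-- The false-alarm event `F_i = {τ_i < ν_i}` (it is empty for `i = 0`). -/
def falseAlarm (f : ℕ → Fin K → Measure ℝ) (X : ℕ → Fin K → Ω → ℝ) (ξ : Ω → Ξ)
    (c : Config K Ξ) (T i : ℕ) : Set Ω :=
  {ω | alarm X ξ c T i ω < (changeTime f T i : ℕ∞)}

/-- The detection event `D_i`: `D_0 = {τ_0 = 0}`, `D_{M-1} = {τ_{M-1} ≤ T}`, and
`D_i = {τ_i ≤ ν_i + h_i}` for `1 ≤ i ≤ M - 2`. -/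
def detected (f : ℕ → Fin K → Measure ℝ) (X : ℕ → Fin K → Ω → ℝ) (ξ : Ω → Ξ)
    (c : Config K Ξ) (T : ℕ) (h : ℕ → ℕ) (i : ℕ) : Set Ω :=
  if i = 0 then {ω | alarm X ξ c T 0 ω = 0}
  else if i = numSegments f T - 1 then {ω | alarm X ξ c T i ω ≤ (T : ℕ∞)}
  else {ω | alarm X ξ c T i ω ≤ ((changeTime f T i + h i : ℕ) : ℕ∞)}

end Events

end

end DimExp

open DimExp

/-! Because the arm of round `t` is chosen before the independent reward vector of round `t` is
drawn, the regret equals the expected sum of mean gaps of the arms played (`regret_eq`). That sum is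
bounded path by path (`sum_loss_le`) and then integrated.

On each path, either there is a first index `i` at which alarm `i` is false or is not raised in due
time, or every alarm needed is correct. A failure costs at most `T`, which produces the two
probability sums. Passing from joint to conditional quantities only enlarges the bound, since
conditioning divides by a probability at most one.

On a good path, segment `i` splits at `τ_{i-1}`. The rounds before it cost at most the delay
`τ_{i-1} - ν_{i-1}`. After it, one epoch runs without restart up to `ν_i`, and the plays of a
suboptimal arm `k` in it are of three kinds (`playCount_epoch_le`). Forced plays number at most `1 +
(2α/K) √length`, because a completed session raises `√u` by at least `K/(2α)`. Plays with few
samples number at most `8 log T / Δ² + 1`. Any other play forces a UCB index to be wrong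
(`estimates_of_ucb_play`). Cauchy–Schwarz over the segments turns the forced plays into `2α √(MT)`.

The wrong indices are delicate because the epoch starts at a random time, sample counts are random,
and absence of later alarms depends on the future. The last condition is dropped: misestimates after
`s` are counted along the arms actually played, whatever the detector does later. Only the event
`{τ_{i-1} = s}` is kept, and it is decided by time `s` (`alarmTime_eq_coe_congr`). On such an event
an exponential supermartingale built from Hoeffding's lemma still works (`lintegral_expWeight_le`).
A union bound over the sample count gives probability at most `P(τ_{i-1} = s) / (t - s)²` per tail.
Summing over `t`, over two tails and over the disjoint events in `s` yields `π²/3` for each arm and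
segment (`integral_segmentMisestimates_le`). -/

namespace DimExp

/-! ### Trajectories of the algorithm and their alarm times -/

section Run

variable {K : ℕ} {Ξ : Type*} (c : Config K Ξ) (ξ : Ξ)

lemma State.step_arm (s : State K) (t : ℕ) (y : Fin K → ℝ) :
    (s.step c ξ t y).arm = Function.update s.arm t (s.decide c t).1 := by
  unfold State.step; dsimp only; split_ifs <;> rfl

lemma State.step_rew (s : State K) (t : ℕ) (y : Fin K → ℝ) :
    (s.step c ξ t y).rew = Function.update s.rew t (y (s.decide c t).1) := by
  unfold State.step; dsimp only; split_ifs <;> rfl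

lemma State.step_tau_u (s : State K) (t : ℕ) (y : Fin K → ℝ) :
    ((s.step c ξ t y).tau = t ∧ (s.step c ξ t y).u = c.restart) ∨
      ((s.step c ξ t y).tau = s.tau ∧ (s.step c ξ t y).u = (s.decide c t).2) := by
  unfold State.step; dsimp only; split_ifs
  · exact Or.inl ⟨rfl, rfl⟩
  · exact Or.inr ⟨rfl, rfl⟩

variable [NeZero K] (x : ℕ → Fin K → ℝ)

lemma run_succ (t : ℕ) :
    run c ξ x (t + 1) = (run c ξ x t).step c ξ (t + 1) (x (t + 1)) := rfl

lemma run_tau_le (t : ℕ) : (run c ξ x t).tau ≤ t := by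
  induction t with
  | zero => exact le_rfl
  | succ t ih =>
    rcases (run c ξ x t).step_tau_u c ξ (t + 1) (x (t + 1)) with h | h
    · rw [run_succ, h.1]
    · rw [run_succ, h.1]; omega

lemma run_tau_succ_of_ne {t : ℕ} (h : (run c ξ x (t + 1)).tau ≠ t + 1) :
    (run c ξ x (t + 1)).tau = (run c ξ x t).tau ∧
      (run c ξ x (t + 1)).u = ((run c ξ x t).decide c (t + 1)).2 :=
  ((run c ξ x t).step_tau_u c ξ (t + 1) (x (t + 1))).resolve_left fun h' => h h'.1

lemma run_tau_eq_of_forall_ne {s t : ℕ} (hst : s ≤ t) (hs : (run c ξ x s).tau = s)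
    (h : ∀ q, s < q → q ≤ t → (run c ξ x q).tau ≠ q) : (run c ξ x t).tau = s := by
  induction t, hst using Nat.le_induction with
  | base => exact hs
  | succ t hst ih =>
    rw [(run_tau_succ_of_ne c ξ x (h (t + 1) (by omega) le_rfl)).1]
    exact ih fun q h1 h2 => h q h1 (by omega)

lemma armAt_succ (t : ℕ) :
    armAt c ξ x (t + 1) = ((run c ξ x t).decide c (t + 1)).1 := by
  rw [armAt, run_succ, State.step_arm, Function.update_self]

lemma run_arm {r t : ℕ} (hrt : r ≤ t) : (run c ξ x t).arm r = armAt c ξ x r := by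
  induction t, hrt using Nat.le_induction with
  | base => rfl
  | succ t hrt ih =>
    rw [run_succ, State.step_arm, Function.update_of_ne (by omega), ih]

lemma run_rew {r t : ℕ} (hr : 1 ≤ r) (hrt : r ≤ t) :
    (run c ξ x t).rew r = x r (armAt c ξ x r) := by
  induction t, hrt using Nat.le_induction with
  | base =>
    obtain ⟨r, rfl⟩ : ∃ m, r = m + 1 := ⟨r - 1, by omega⟩
    rw [run_succ, State.step_rew, Function.update_self, armAt_succ]
  | succ t hrt ih =>
    rw [run_succ, State.step_rew, Function.update_of_ne (by omega), ih]

variable {x} {y : ℕ → Fin K → ℝ}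

lemma run_congr {t : ℕ} (h : ∀ r, 1 ≤ r → r ≤ t → x r = y r) :
    run c ξ x t = run c ξ y t := by
  induction t with
  | zero => rfl
  | succ t ih =>
    rw [run_succ, run_succ, ih fun r h1 h2 => h r h1 (by omega), h (t + 1) (by omega) le_rfl]

lemma armAt_congr {t : ℕ} (h : ∀ r, 1 ≤ r → r < t → x r = y r) :
    armAt c ξ x t = armAt c ξ y t := by
  cases t with
  | zero => rfl
  | succ t =>
    rw [armAt_succ, armAt_succ, run_congr c ξ fun r h1 h2 => h r h1 (by omega)]

lemma alarmTime_congr {T : ℕ} (h : ∀ r, 1 ≤ r → r ≤ T → x r = y r) (i : ℕ) :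
    alarmTime c ξ x T i = alarmTime c ξ y T i := by
  induction i with
  | zero => rfl
  | succ i ih =>
    unfold alarmTime
    congr 1
    ext n
    refine exists_congr fun t => and_congr_right fun _ => and_congr_right fun ht => ?_
    rw [ih, run_congr c ξ fun r h1 h2 => h r h1 (h2.trans ht)]

variable (x)

lemma alarmTime_succ_le {T i s : ℕ} (hs : s ≤ T) (h : alarmTime c ξ x T i < s)
    (hr : (run c ξ x s).tau = s) : alarmTime c ξ x T (i + 1) ≤ s := by
  rw [alarmTime]
  exact sInf_le ⟨s, rfl, hs, h, hr⟩

lemma exists_of_alarmTime_succ_ne_top {T i : ℕ} (h : alarmTime c ξ x T (i + 1) ≠ ⊤) :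
    ∃ s : ℕ, alarmTime c ξ x T (i + 1) = s ∧ s ≤ T ∧ alarmTime c ξ x T i < s ∧
      (run c ξ x s).tau = s := by
  rw [alarmTime] at h ⊢
  refine csInf_mem (s := {n : ℕ∞ | ∃ t : ℕ, n = t ∧ t ≤ T ∧ alarmTime c ξ x T i < t ∧
      (run c ξ x t).tau = t}) ?_
  by_contra hne
  rw [Set.not_nonempty_iff_eq_empty] at hne
  exact h (by rw [hne, sInf_empty])

lemma exists_of_alarmTime_ne_top {T i : ℕ} (h : alarmTime c ξ x T i ≠ ⊤) :
    ∃ s : ℕ, alarmTime c ξ x T i = s ∧ s ≤ T ∧ (run c ξ x s).tau = s := by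
  cases i with
  | zero => exact ⟨0, rfl, Nat.zero_le _, rfl⟩
  | succ i =>
    obtain ⟨s, h1, h2, -, h3⟩ := exists_of_alarmTime_succ_ne_top c ξ x h
    exact ⟨s, h1, h2, h3⟩

/-- Replaces the infimum by finitely many conditions on the states up to time `s`. Both the
stopping-time property and the measurability of `{τ_i = s}` are read off from this form. -/
lemma alarmTime_succ_eq_coe_iff {T i s : ℕ} :
    alarmTime c ξ x T (i + 1) = s ↔ s ≤ T ∧ (run c ξ x s).tau = s ∧
      ∃ r < s, alarmTime c ξ x T i = r ∧ ∀ q, r < q → q < s → (run c ξ x q).tau ≠ q := by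
  constructor
  · intro h
    obtain ⟨s', h1, h2, h3, h4⟩ := exists_of_alarmTime_succ_ne_top c ξ x
      (by rw [h]; exact ENat.natCast_ne_top s : alarmTime c ξ x T (i + 1) ≠ ⊤)
    obtain rfl : s' = s := by exact_mod_cast h1.symm.trans h
    obtain ⟨r, hr, -⟩ := exists_of_alarmTime_ne_top c ξ x h3.ne_top
    refine ⟨h2, h4, r, by rw [hr] at h3; exact_mod_cast h3, hr, fun q h5 h6 h7 => ?_⟩
    have := alarmTime_succ_le c ξ x (i := i) (h6.le.trans h2) (by rw [hr]; exact_mod_cast h5) h7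
    rw [h1] at this
    exact absurd h6 (not_lt.2 (by exact_mod_cast this))
  · rintro ⟨h1, h2, r, h3, h4, h5⟩
    have hle := alarmTime_succ_le c ξ x (i := i) h1 (by rw [h4]; exact_mod_cast h3) h2
    obtain ⟨s', h1', h2', h3', h4'⟩ := exists_of_alarmTime_succ_ne_top c ξ x
      (ne_top_of_le_ne_top (ENat.natCast_ne_top s) hle)
    rw [h1'] at hle ⊢
    rw [h4] at h3'
    have e1 : s' ≤ s := by exact_mod_cast hle
    have e2 : r < s' := by exact_mod_cast h3'
    rcases e1.lt_or_eq with h6 | h6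
    · exact absurd h4' (h5 s' e2 h6)
    · rw [h6]

/-- The stopping-time property: rewards after `s` have no say in whether the `i`-th alarm is at `s`.
-/
lemma alarmTime_eq_coe_congr {y : ℕ → Fin K → ℝ} {s : ℕ}
    (h : ∀ r, 1 ≤ r → r ≤ s → x r = y r) (T i : ℕ) :
    alarmTime c ξ x T i = s ↔ alarmTime c ξ y T i = s := by
  induction i generalizing s with
  | zero => rfl
  | succ i ih =>
    rw [alarmTime_succ_eq_coe_iff, alarmTime_succ_eq_coe_iff, run_congr c ξ h]
    refine and_congr_right fun _ => and_congr_right fun _ => exists_congr fun r =>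
      and_congr_right fun hr => ?_
    rw [ih fun q h1 h2 => h q h1 (by omega)]
    refine and_congr_right fun _ => forall_congr' fun q => imp_congr_right fun _ =>
      imp_congr_right fun hq => ?_
    rw [run_congr c ξ fun q' h1 h2 => h q' h1 (by omega)]

lemma run_tau_eq_of_lt_alarmTime {T i s t : ℕ} (hs : alarmTime c ξ x T i = s) (hst : s ≤ t)
    (htT : t ≤ T) (h : (t : ℕ∞) < alarmTime c ξ x T (i + 1)) : (run c ξ x t).tau = s := by
  have hs' : (run c ξ x s).tau = s := by
    obtain ⟨s', h1, -, h2⟩ := exists_of_alarmTime_ne_top c ξ x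
      (by rw [hs]; exact ENat.natCast_ne_top s : alarmTime c ξ x T i ≠ ⊤)
    obtain rfl : s' = s := by exact_mod_cast h1.symm.trans hs
    exact h2
  refine run_tau_eq_of_forall_ne c ξ x hst hs' fun q h1 h2 h3 => ?_
  have := alarmTime_succ_le c ξ x (i := i) (h2.trans htT) (by rw [hs]; exact_mod_cast h1) h3
  exact absurd (h.trans_le this) (not_lt.2 (by exact_mod_cast h2))

end Run

/-! ### The exploration schedule -/

lemma card_filter_Ioc_succ (p : ℕ → Prop) [DecidablePred p] {s t : ℕ} (h : s ≤ t) :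
    ((Finset.Ioc s (t + 1)).filter p).card
      = ((Finset.Ioc s t).filter p).card + if p (t + 1) then 1 else 0 := by
  rw [← Finset.insert_Ioc_right_eq_Ioc_add_one h, Finset.filter_insert]
  split_ifs with hp
  · rw [Finset.card_insert_of_notMem (by simp)]
  · rfl

/-- The update rule is a completed square: `u + (K/α) √u + K²/(4α²) = (√u + K/(2α))²`, and rounding
up only helps. -/
lemma sqrt_add_le_sqrt_nextStart (K : ℕ) {α : ℝ} (hα : 0 < α) (u : ℕ) :
    Real.sqrt u + K / (2 * α) ≤ Real.sqrt (nextStart K α u) := by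
  refine Real.le_sqrt_of_sq_le (le_trans (le_of_eq ?_) (Nat.le_ceil _))
  have h := Real.sq_sqrt (Nat.cast_nonneg (α := ℝ) u)
  have : K / α * Real.sqrt u = 2 * Real.sqrt u * (K / (2 * α)) := by field_simp
  rw [add_sq, h, this, div_pow]
  ring

lemma lt_nextStart {K : ℕ} [NeZero K] {α : ℝ} (hα : 0 < α) (u : ℕ) : u < nextStart K α u := by
  have hK : (0 : ℝ) < K := by exact_mod_cast Nat.pos_of_ne_zero (NeZero.ne K)
  refine Nat.lt_ceil.2 ?_
  have h1 : 0 ≤ K / α * Real.sqrt u := by positivity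
  have h2 : 0 < (K : ℝ) ^ 2 / (4 * α ^ 2) := by positivity
  linarith

section Decide

variable {K : ℕ} {Ξ : Type*} (c : Config K Ξ)

lemma State.decide_of_explores {s : State K} {t : ℕ} (h : s.u ≤ t - s.tau ∧ t - s.tau < s.u + K) :
    s.decide c t = (⟨(t - s.tau) - s.u, by omega⟩, s.u) := dif_pos h

lemma State.decide_of_not_explores {s : State K} {t : ℕ}
    (h : ¬(s.u ≤ t - s.tau ∧ t - s.tau < s.u + K)) :
    s.decide c t = (c.tie (s.maximizers t),
      if t - s.tau = s.u + K then nextStart K c.α s.u else s.u) := dif_neg h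

end Decide

/-! ### Plays of an arm in an epoch without alarm -/

section Epoch

variable {K : ℕ} [NeZero K] {Ξ : Type*} (c : Config K Ξ) (ξ : Ξ) (x : ℕ → Fin K → ℝ)

/-- The number of plays of arm `k` during `s + 1, …, t`. -/
noncomputable def playCount (s t : ℕ) (k : Fin K) : ℕ :=
  ((Finset.Ioc s t).filter fun r => armAt c ξ x r = k).card

/-- The sum of the rewards of arm `k`, centred at `m`, during `s + 1, …, t`. -/
noncomputable def deviation (s t : ℕ) (k : Fin K) (m : ℝ) : ℝ :=
  ∑ r ∈ (Finset.Ioc s t).filter fun r => armAt c ξ x r = k, (x r k - m)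

/-- In round `t` of an epoch started at `s`, the UCB index of arm `k` minus its confidence width
overestimates `m`. -/
def OverEstimates (s t : ℕ) (k : Fin K) (m : ℝ) : Prop :=
  1 ≤ playCount c ξ x s (t - 1) k ∧
    Real.sqrt (2 * playCount c ξ x s (t - 1) k * Real.log (t - s : ℕ))
      ≤ deviation c ξ x s (t - 1) k m

/-- In round `t` of an epoch started at `s`, the UCB index of arm `k` underestimates `m`. -/
def UnderEstimates (s t : ℕ) (k : Fin K) (m : ℝ) : Prop :=
  1 ≤ playCount c ξ x s (t - 1) k ∧
    deviation c ξ x s (t - 1) k m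
      ≤ -Real.sqrt (2 * playCount c ξ x s (t - 1) k * Real.log (t - s : ℕ))

/-- Round `t` belongs to a uniform exploration session. -/
def Explores (t : ℕ) : Prop :=
  (run c ξ x (t - 1)).u ≤ t - (run c ξ x (t - 1)).tau ∧
    t - (run c ξ x (t - 1)).tau < (run c ξ x (t - 1)).u + K

variable {s e : ℕ} (hs : ∀ t, s ≤ t → t < e → (run c ξ x t).tau = s)
include hs

open Classical in
/-- Completed exploration sessions raise `√u` by `K / (2 α)` each. -/
lemma explores_card_le_sqrt_start (hα : 0 < c.α) (k : Fin K) {t : ℕ} (hst : s ≤ t) (hte : t < e) :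
    t - s < (run c ξ x t).u + K ∧
    (((Finset.Ioc s t).filter fun r => Explores c ξ x r ∧ armAt c ξ x r = k).card : ℝ)
      ≤ 2 * c.α / K * Real.sqrt (run c ξ x t).u
        + if (run c ξ x t).u + k ≤ t - s then 1 else 0 := by
  have hK : 0 < K := Nat.pos_of_ne_zero (NeZero.ne K)
  have hK' : (0 : ℝ) < K := by exact_mod_cast hK
  induction t, hst using Nat.le_induction with
  | base =>
    refine ⟨by omega, ?_⟩
    simp only [Finset.Ioc_self, Finset.filter_empty, Finset.card_empty, Nat.cast_zero]
    positivity
  | succ t hst ih =>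
    obtain ⟨iha, ihb⟩ := ih (by omega)
    have htau := hs t hst (by omega)
    have hu := (run_tau_succ_of_ne c ξ x (t := t) (by rw [hs (t + 1) (by omega) hte]; omega)).2
    rw [card_filter_Ioc_succ _ hst, hu, armAt_succ]
    by_cases hex : (run c ξ x t).u ≤ t + 1 - (run c ξ x t).tau ∧
        t + 1 - (run c ξ x t).tau < (run c ξ x t).u + K
    · have hE : Explores c ξ x (t + 1) := hex
      rw [State.decide_of_explores c hex]
      rw [htau] at hex
      refine ⟨hex.2, ?_⟩
      simp only [hE, true_and, htau, Nat.cast_add]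
      refine (add_le_add_left ihb _).trans ?_
      rw [add_assoc]
      gcongr
      -- Exploring arm `k` now means `t + 1 - s = u + k`, so the indicator jumps from 0 to 1 exactly
      -- when the count does.
      split_ifs with h1 h2 h3 h3 h2 h3 h3 <;> simp only [Fin.ext_iff] at * <;>
        first | omega | norm_num
    · have hE : ¬ Explores c ξ x (t + 1) := hex
      rw [State.decide_of_not_explores c hex]
      rw [htau] at hex
      simp only [hE, false_and, if_false, add_zero, htau]
      by_cases hup : t + 1 - s = (run c ξ x t).u + K
      · rw [if_pos hup]
        have hlt := lt_nextStart (K := K) hα (run c ξ x t).u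
        refine ⟨by omega, ihb.trans ?_⟩
        -- The session has just ended: the new `u` raises `2 * c.α / K * √u` by at least 1, which
        -- absorbs the old indicator.
        have h1 := sqrt_add_le_sqrt_nextStart K hα (run c ξ x t).u
        have h2 : (if (run c ξ x t).u + k ≤ t - s then (1 : ℝ) else 0) ≤ 1 := by
          split_ifs <;> norm_num
        have h3 : (0 : ℝ) ≤ if nextStart K c.α (run c ξ x t).u + k ≤ t + 1 - s then 1 else 0 := by
          positivity
        have h4 := mul_le_mul_of_nonneg_left h1 (by positivity : 0 ≤ 2 * c.α / K)
        have h5 : 2 * c.α / K * (Real.sqrt (run c ξ x t).u + K / (2 * c.α))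
            = 2 * c.α / K * Real.sqrt (run c ξ x t).u + 1 := by field_simp
        linarith
      · rw [if_neg hup]
        refine ⟨by omega, ihb.trans ?_⟩
        gcongr
        split_ifs <;> first | omega | norm_num

open Classical in
-- The count changes only at an exploratory play of `k`, where `u` is at most the elapsed time, so
-- `√u` may be replaced by its root. Round `e` is allowed, even if it raises an alarm, since its
-- decision uses only the state at `e - 1`.
lemma explores_card_le (hα : 0 < c.α) (k : Fin K) {t : ℕ} (hst : s ≤ t) (hte : t ≤ e) :
    (((Finset.Ioc s t).filter fun r => Explores c ξ x r ∧ armAt c ξ x r = k).card : ℝ)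
      ≤ 1 + 2 * c.α / K * Real.sqrt (t - s : ℕ) := by
  induction t, hst using Nat.le_induction with
  | base =>
    simp only [Finset.Ioc_self, Finset.filter_empty, Finset.card_empty, Nat.cast_zero]
    positivity
  | succ t hst ih =>
    have hmono : 1 + 2 * c.α / K * Real.sqrt (t - s : ℕ)
        ≤ 1 + 2 * c.α / K * Real.sqrt (t + 1 - s : ℕ) := by
      gcongr
      omega
    rw [card_filter_Ioc_succ _ hst]
    split_ifs with h
    · obtain ⟨hE, hk⟩ := h
      have htau := hs t hst (by omega)
      have hb := (explores_card_le_sqrt_start c ξ x hs hα k hst (by omega)).2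
      have hE' : (run c ξ x t).u ≤ t + 1 - (run c ξ x t).tau ∧
          t + 1 - (run c ξ x t).tau < (run c ξ x t).u + K := hE
      rw [armAt_succ, State.decide_of_explores c hE'] at hk
      rw [htau] at hE'
      simp only [htau, Fin.ext_iff] at hk
      -- Round `t + 1` is the turn of arm `k`, so the current session had not yet played it and the
      -- indicator at `t` vanishes.
      rw [if_neg (by omega), add_zero] at hb
      have : 2 * c.α / K * Real.sqrt (run c ξ x t).u
          ≤ 2 * c.α / K * Real.sqrt (t + 1 - s : ℕ) := by
        gcongr
        exact hE'.1
      push_cast at this hb ⊢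
      linarith
    · exact (ih (by omega)).trans hmono

omit hs in
lemma maximizers_nonempty (st : State K) (t : ℕ) : (st.maximizers t).Nonempty := by
  obtain ⟨k, -, hk⟩ := Finset.exists_max_image Finset.univ (st.index t) Finset.univ_nonempty
  exact ⟨k, by simpa [State.maximizers] using hk⟩

lemma count_run {t : ℕ} (hst : s ≤ t) (hte : t < e) (k : Fin K) :
    (run c ξ x t).count t k = playCount c ξ x s t k := by
  unfold State.count playCount
  rw [hs t hst hte]
  congr 1
  refine Finset.filter_congr fun r hr => ?_
  rw [run_arm c ξ x (Finset.mem_Ioc.1 hr).2]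

lemma total_run {t : ℕ} (hst : s ≤ t) (hte : t < e) (k : Fin K) (m : ℝ) :
    (run c ξ x t).total t k = deviation c ξ x s t k m + playCount c ξ x s t k * m := by
  unfold State.total playCount deviation
  rw [hs t hst hte, Finset.sum_sub_distrib, Finset.sum_const, nsmul_eq_mul, sub_add_cancel]
  have : (Finset.Ioc s t).filter (fun r => (run c ξ x t).arm r = k)
      = (Finset.Ioc s t).filter (fun r => armAt c ξ x r = k) :=
    Finset.filter_congr fun r hr => by rw [run_arm c ξ x (Finset.mem_Ioc.1 hr).2]
  rw [this]
  refine Finset.sum_congr rfl fun r hr => ?_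
  obtain ⟨h1, h2⟩ := Finset.mem_filter.1 hr
  rw [Finset.mem_Ioc] at h1
  rw [run_rew c ξ x (by omega) h1.2, h2]

/-- A sufficiently sampled suboptimal arm is chosen by its UCB index only if some index is off. -/
lemma estimates_of_ucb_play (htie : ∀ S : Finset (Fin K), S.Nonempty → c.tie S ∈ S)
    {t T : ℕ} (hst : s < t) (hte : t ≤ e) (hT : t - s ≤ T) (hE : ¬ Explores c ξ x t)
    {j k : Fin K} (hk : armAt c ξ x t = k) {m m' : ℝ} (hm : m < m')
    (hn : 8 * Real.log T / (m' - m) ^ 2 < playCount c ξ x s (t - 1) k) :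
    OverEstimates c ξ x s t k m ∨ UnderEstimates c ξ x s t j m' := by
  obtain ⟨t, rfl⟩ : ∃ q, t = q + 1 := ⟨t - 1, by omega⟩
  simp only [OverEstimates, UnderEstimates, Nat.add_sub_cancel] at hn ⊢
  have hE' : ¬((run c ξ x t).u ≤ t + 1 - (run c ξ x t).tau ∧
    t + 1 - (run c ξ x t).tau < (run c ξ x t).u + K) := hE
  rw [armAt_succ, State.decide_of_not_explores c hE'] at hk
  have hmem := htie _ (maximizers_nonempty (run c ξ x t) (t + 1))
  change c.tie _ = k at hk
  rw [hk] at hmem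
  have hmax : (run c ξ x t).index (t + 1) j ≤ (run c ξ x t).index (t + 1) k := by
    simp only [State.maximizers, Finset.mem_filter] at hmem
    exact hmem.2 j
  simp only [State.index, Nat.add_sub_cancel, count_run c ξ x hs (by omega : s ≤ t) (by omega),
    total_run c ξ x hs (by omega : s ≤ t) (by omega) k m,
    total_run c ξ x hs (by omega : s ≤ t) (by omega) j m', hs t (by omega) (by omega)] at hmax
  have hL : 0 ≤ Real.log T := Real.log_natCast_nonneg T
  have hl : 0 ≤ Real.log (t + 1 - s : ℕ) := Real.log_natCast_nonneg _
  have hlL : Real.log (t + 1 - s : ℕ) ≤ Real.log T :=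
    Real.log_le_log (by exact_mod_cast (by omega : 0 < t + 1 - s)) (by exact_mod_cast hT)
  have hΔ : 0 < m' - m := by linarith
  have hnk : (0 : ℝ) < playCount c ξ x s t k := lt_of_le_of_lt (by positivity) hn
  have hnk' : 0 < playCount c ξ x s t k := by exact_mod_cast hnk
  rw [if_neg hnk'.ne'] at hmax
  -- An unsampled `j` would have index `⊤` and beat the finite index of `k`.
  have hnj : 0 < playCount c ξ x s t j := by
    by_contra h0
    rw [if_pos (by omega), top_le_iff] at hmax
    exact EReal.coe_ne_top _ hmax
  have hnj' : (0 : ℝ) < playCount c ξ x s t j := by exact_mod_cast hnj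
  rw [if_neg hnj.ne', EReal.coe_le_coe_iff] at hmax
  by_contra hcon
  simp only [not_or, not_and, not_le] at hcon
  have hk1 := hcon.1 hnk'
  have hj1 := hcon.2 hnj
  set l := Real.log (t + 1 - s : ℕ)
  have key : ∀ {a : ℝ}, 0 < a → Real.sqrt (2 * a * l) = a * Real.sqrt (2 * l / a) := by
    intro a ha
    rw [show 2 * a * l = a ^ 2 * (2 * l / a) by field_simp, Real.sqrt_mul (by positivity),
      Real.sqrt_sq ha.le]
  rw [key hnk] at hk1
  rw [key hnj'] at hj1
  rw [add_div, add_div, mul_div_cancel_left₀ _ hnk.ne', mul_div_cancel_left₀ _ hnj'.ne'] at hmax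
  have hk2 : deviation c ξ x s t k m / playCount c ξ x s t k
      < Real.sqrt (2 * l / playCount c ξ x s t k) := by
    rw [div_lt_iff₀ hnk]; linarith
  have hj2 : -Real.sqrt (2 * l / playCount c ξ x s t j)
      < deviation c ξ x s t j m' / playCount c ξ x s t j := by
    rw [lt_div_iff₀ hnj']; linarith
  -- The threshold `8 log T / (m' - m)²` is what makes the width at most half the gap. Then the
  -- index of `k` is below `m` plus twice its width, hence below `m'`, while that of `j` exceeds
  -- `m'`.
  have hw : Real.sqrt (2 * l / playCount c ξ x s t k) ≤ (m' - m) / 2 := by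
    refine Real.sqrt_le_iff.2 ⟨by linarith, ?_⟩
    rw [div_lt_iff₀ (by positivity)] at hn
    rw [div_le_iff₀ hnk]
    nlinarith
  linarith

open Classical in
/-- The number of plays of a suboptimal arm in an epoch without alarm. -/
lemma playCount_epoch_le (hα : 0 < c.α)
    (htie : ∀ S : Finset (Fin K), S.Nonempty → c.tie S ∈ S) {T : ℕ} (hse : s ≤ e)
    (hT : e - s ≤ T) (j k : Fin K) {m m' : ℝ} (hm : m < m') :
    (playCount c ξ x s e k : ℝ)
      ≤ ((Finset.Ioc s e).filter fun t =>
          OverEstimates c ξ x s t k m ∨ UnderEstimates c ξ x s t j m').card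
        + (8 * Real.log T / (m' - m) ^ 2 + 1) + (1 + 2 * c.α / K * Real.sqrt (e - s : ℕ)) := by
  set a := 8 * Real.log T / (m' - m) ^ 2 with ha
  have ha0 : 0 ≤ a := by
    have := Real.log_natCast_nonneg T
    positivity
  set R := (Finset.Ioc s e).filter fun t =>
    armAt c ξ x t = k ∧ (playCount c ξ x s (t - 1) k : ℝ) ≤ a with hR
  have hRcard : (R.card : ℝ) ≤ a + 1 := by
    have : R.card ≤ (Finset.range (⌊a⌋₊ + 1)).card := by
      -- Each play of `k` increases its count, so the count just before a play identifies it; on `R`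
      -- this count lies in `{0, …, ⌊a⌋}`.
      refine Finset.card_le_card_of_injOn (fun t => playCount c ξ x s (t - 1) k) ?_ ?_
      · intro t ht
        simp only [hR, Finset.coe_filter, Set.mem_ofPred_eq] at ht
        simp only [Finset.coe_range, Set.mem_Iio]
        exact Nat.lt_succ_of_le (Nat.le_floor ht.2.2)
      · have hlt : ∀ t ∈ R, ∀ t', t < t' →
            playCount c ξ x s (t - 1) k < playCount c ξ x s (t' - 1) k := by
          intro t ht t' htt'
          simp only [hR, Finset.mem_filter, Finset.mem_Ioc] at ht
          obtain ⟨q, rfl⟩ : ∃ q, t = q + 1 := ⟨t - 1, by omega⟩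
          have h1 : playCount c ξ x s (q + 1) k = playCount c ξ x s q k + 1 := by
            unfold playCount
            rw [card_filter_Ioc_succ _ (by omega), if_pos ht.2.1]
          have h2 : playCount c ξ x s (q + 1) k ≤ playCount c ξ x s (t' - 1) k :=
            Finset.card_le_card (Finset.filter_subset_filter _
              (Finset.Ioc_subset_Ioc_right (by omega)))
          rw [Nat.add_sub_cancel]
          omega
        intro t ht t' ht' heq
        rcases lt_trichotomy t t' with h | h | h
        · exact absurd heq (hlt t ht t' h).ne
        · exact h
        · exact absurd heq (hlt t' ht' t h).ne'
    rw [Finset.card_range] at this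
    calc (R.card : ℝ) ≤ (⌊a⌋₊ + 1 : ℕ) := by exact_mod_cast this
      _ ≤ a + 1 := by push_cast; gcongr; exact Nat.floor_le ha0
  have hE := explores_card_le c ξ x hs hα k hse le_rfl
  -- A play of `k` is exploratory, or made with at most `a` samples, or chosen by index with more
  -- than `a` samples, which forces a misestimate.
  have hsub : (Finset.Ioc s e).filter (fun t => armAt c ξ x t = k) ⊆
      (((Finset.Ioc s e).filter fun t =>
          OverEstimates c ξ x s t k m ∨ UnderEstimates c ξ x s t j m') ∪ R) ∪
        ((Finset.Ioc s e).filter fun r => Explores c ξ x r ∧ armAt c ξ x r = k) := by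
    intro t ht
    obtain ⟨h1, h2⟩ := Finset.mem_filter.1 ht
    have h3 := Finset.mem_Ioc.1 h1
    simp only [hR, Finset.mem_union, Finset.mem_filter, h1, h2, true_and, and_true]
    by_cases hEx : Explores c ξ x t
    · exact Or.inr hEx
    · refine Or.inl ?_
      by_cases hsm : (playCount c ξ x s (t - 1) k : ℝ) ≤ a
      · exact Or.inr hsm
      · exact Or.inl (estimates_of_ucb_play c ξ x hs htie h3.1 h3.2 (by omega) hEx h2 hm
          (not_le.1 hsm))
  have hcard := (Finset.card_le_card hsub).trans ((Finset.card_union_le _ _).trans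
    (Nat.add_le_add_right (Finset.card_union_le _ _) _))
  have hcard' : (playCount c ξ x s e k : ℝ) ≤ _ := Nat.cast_le.2 hcard
  push_cast at hcard'
  linarith

end Epoch

/-! ### Measurability of the trajectory -/

section Measurability

variable {K : ℕ} {Ξ : Type*}

/-- The σ-algebra generated by the four components of the state. -/
instance : MeasurableSpace (State K) :=
  MeasurableSpace.comap (fun s => (s.tau, s.u, s.arm, s.rew)) inferInstance

lemma State.measurable_components :
    Measurable fun s : State K => (s.tau, s.u, s.arm, s.rew) :=
  comap_measurable _

lemma State.measurable_tau : Measurable (State.tau (K := K)) :=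
  State.measurable_components.fst

lemma State.measurable_u : Measurable (State.u (K := K)) :=
  State.measurable_components.snd.fst

lemma State.measurable_arm : Measurable (State.arm (K := K)) :=
  State.measurable_components.snd.snd.fst

lemma State.measurable_rew : Measurable (State.rew (K := K)) :=
  State.measurable_components.snd.snd.snd

lemma State.measurable_arm_apply (r : ℕ) : Measurable fun s : State K => s.arm r :=
  (measurable_pi_apply r).comp State.measurable_arm

lemma State.measurable_rew_apply (r : ℕ) : Measurable fun s : State K => s.rew r :=
  (measurable_pi_apply r).comp State.measurable_rew

lemma State.measurable_mk {α : Type*} [MeasurableSpace α] {g : α → State K}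
    (h1 : Measurable fun a => (g a).tau) (h2 : Measurable fun a => (g a).u)
    (h3 : Measurable fun a => (g a).arm) (h4 : Measurable fun a => (g a).rew) :
    Measurable g :=
  measurable_comap_iff.2 (h1.prodMk (h2.prodMk (h3.prodMk h4)))

lemma measurable_apply_fin {α β : Type*} [MeasurableSpace α] [MeasurableSpace β]
    {y : α → Fin K → β} {d : α → Fin K} (hy : ∀ k, Measurable fun a => y a k)
    (hd : Measurable d) : Measurable fun a => y a (d a) := by
  intro S hS
  have : (fun a => y a (d a)) ⁻¹' S = ⋃ k, (d ⁻¹' {k}) ∩ ((fun a => y a k) ⁻¹' S) := by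
    ext a; simp
  rw [this]
  exact MeasurableSet.iUnion fun k => (hd (measurableSet_singleton k)).inter (hy k hS)

lemma State.measurableSet_mem_filter (r : ℕ) (k : Fin K) :
    MeasurableSet {s : State K | s.tau < r ∧ s.arm r = k} :=
  (measurableSet_lt State.measurable_tau measurable_const).inter
    (State.measurable_arm_apply r (measurableSet_singleton k))

lemma State.measurable_count (t : ℕ) (k : Fin K) :
    Measurable fun s : State K => s.count t k := by
  have : (fun s : State K => s.count t k)
      = fun s => ∑ r ∈ Finset.Iic t, if s.tau < r ∧ s.arm r = k then 1 else 0 := by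
    ext s
    rw [State.count, Finset.card_filter, Finset.sum_ite, Finset.sum_ite]
    simp only [Finset.sum_const_zero, add_zero]
    congr 1
    ext r
    simp only [Finset.mem_filter, Finset.mem_Ioc, Finset.mem_Iic]
    tauto
  rw [this]
  exact Finset.measurable_sum _ fun r _ =>
    Measurable.ite (State.measurableSet_mem_filter r k) measurable_const measurable_const

lemma State.measurable_total (t : ℕ) (k : Fin K) :
    Measurable fun s : State K => s.total t k := by
  have : (fun s : State K => s.total t k)
      = fun s => ∑ r ∈ Finset.Iic t, if s.tau < r ∧ s.arm r = k then s.rew r else 0 := by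
    ext s
    rw [State.total, ← Finset.sum_filter]
    refine Finset.sum_congr ?_ fun _ _ => rfl
    ext r
    simp only [Finset.mem_filter, Finset.mem_Ioc, Finset.mem_Iic]
    tauto
  rw [this]
  exact Finset.measurable_sum _ fun r _ =>
    Measurable.ite (State.measurableSet_mem_filter r k) (State.measurable_rew_apply r)
      measurable_const

lemma State.measurable_index (t : ℕ) (k : Fin K) :
    Measurable fun s : State K => s.index t k := by
  have hc := State.measurable_count (K := K) (t - 1) k
  have hc' : Measurable fun s : State K => (s.count (t - 1) k : ℝ) :=
    (measurable_of_countable _).comp hc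
  have hl : Measurable fun s : State K => Real.log ((t - s.tau : ℕ) : ℝ) :=
    (measurable_of_countable fun n : ℕ => Real.log ((t - n : ℕ) : ℝ)).comp State.measurable_tau
  refine Measurable.ite (hc (measurableSet_singleton 0)) measurable_const ?_
  exact (((State.measurable_total _ k).div hc').add
    (((hl.const_mul 2).div hc').sqrt)).coe_real_ereal

/-- The set of maximizers has finitely many possible values, each described by comparisons of
indices, so any tie rule is measurable. -/
lemma State.measurable_choice (c : Config K Ξ) (t : ℕ) :
    Measurable fun s : State K => c.tie (s.maximizers t) := by
  let _ : MeasurableSpace (Finset (Fin K)) := ⊤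
  have : DiscreteMeasurableSpace (Finset (Fin K)) := ⟨fun _ => trivial⟩
  refine (measurable_of_countable c.tie).comp (measurable_to_countable' fun S => ?_)
  have : (fun s : State K => s.maximizers t) ⁻¹' {S}
      = ⋂ k, {s : State K | (∀ j, s.index t j ≤ s.index t k) ↔ k ∈ S} := by
    ext s
    simp [State.maximizers, Finset.ext_iff]
  rw [this]
  refine MeasurableSet.iInter fun k => MeasurableSet.iff ?_ (MeasurableSet.const _)
  simp only [Set.ofPred_forall]
  exact MeasurableSet.iInter fun j =>
    measurableSet_le (State.measurable_index t j) (State.measurable_index t k)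

lemma State.measurable_decide (c : Config K Ξ) (t : ℕ) :
    Measurable fun s : State K => s.decide c t :=
  (measurable_of_countable fun p : ℕ × ℕ × Fin K =>
    if h : p.2.1 ≤ t - p.1 ∧ t - p.1 < p.2.1 + K then
      ((⟨(t - p.1) - p.2.1, by omega⟩ : Fin K), p.2.1)
    else (p.2.2, if t - p.1 = p.2.1 + K then nextStart K c.α p.2.1 else p.2.1)).comp
    (State.measurable_tau.prodMk (State.measurable_u.prodMk (State.measurable_choice c t)))

lemma measurable_update_apply {α β : Type*} [MeasurableSpace α] [MeasurableSpace β]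
    {g : α → ℕ → β} {b : α → β} (hg : Measurable g) (hb : Measurable b) (t : ℕ) :
    Measurable fun a => Function.update (g a) t (b a) := by
  refine measurable_pi_iff.2 fun r => ?_
  by_cases h : r = t
  · subst h; simpa using hb
  · simp only [Function.update_of_ne h]
    exact (measurable_pi_apply r).comp hg

variable {α : Type*} [MeasurableSpace α] {c : Config K Ξ}

lemma State.measurable_play {g : α → State K} {y : α → Fin K → ℝ} (hg : Measurable g)
    (hy : Measurable y) (t : ℕ) : Measurable fun a => (g a).play c t (y a) := by
  have hd := (State.measurable_decide c t).comp hg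
  have htau : Measurable fun a => (g a).tau := State.measurable_tau.comp hg
  refine State.measurable_mk htau hd.snd ?_ ?_
  · exact measurable_update_apply (State.measurable_arm.comp hg) hd.fst t
  · exact measurable_update_apply (State.measurable_rew.comp hg)
      (measurable_apply_fin (fun k => (measurable_pi_apply k).comp hy) hd.fst) t

variable [MeasurableSpace Ξ]

lemma State.measurable_step (hcd : ∀ t τ : ℕ, MeasurableSet
      {p : Ξ × (ℕ → Fin K) × (ℕ → ℝ) | c.cd p.1 t τ p.2.1 p.2.2})
    {g : α → State K} {ξ : α → Ξ} {y : α → Fin K → ℝ} (hg : Measurable g)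
    (hξ : Measurable ξ) (hy : Measurable y) (t : ℕ) :
    Measurable fun a => (g a).step c (ξ a) t (y a) := by
  classical
  have hp := State.measurable_play (c := c) hg hy t
  have h1 : MeasurableSet {a | c.w ≤ ((g a).play c t (y a)).count t
      (((g a).play c t (y a)).arm t)} :=
    measurableSet_le measurable_const (measurable_apply_fin
      (fun k => (State.measurable_count t k).comp hp) ((State.measurable_arm_apply t).comp hp))
  have h2 : MeasurableSet {a | c.cd (ξ a) t ((g a).play c t (y a)).tau
      ((g a).play c t (y a)).arm ((g a).play c t (y a)).rew} := by
    -- The detector is measurable for each fixed alarm time; a countable union over its values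
    -- handles a random one.
    have : {a | c.cd (ξ a) t ((g a).play c t (y a)).tau
        ((g a).play c t (y a)).arm ((g a).play c t (y a)).rew}
        = ⋃ τ : ℕ, {a | ((g a).play c t (y a)).tau = τ} ∩
          {a | c.cd (ξ a) t τ ((g a).play c t (y a)).arm ((g a).play c t (y a)).rew} := by
      ext a; simp
    rw [this]
    exact MeasurableSet.iUnion fun τ =>
      ((State.measurable_tau.comp hp) (measurableSet_singleton τ)).inter
        ((hξ.prodMk ((State.measurable_arm.comp hp).prodMk (State.measurable_rew.comp hp)))
          (hcd t τ))
  refine Measurable.ite (h1.inter h2) ?_ hp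
  have harm : Measurable fun a => ((g a).play c t (y a)).arm := State.measurable_arm.comp hp
  have hrew : Measurable fun a => ((g a).play c t (y a)).rew := State.measurable_rew.comp hp
  exact State.measurable_mk measurable_const measurable_const harm hrew

variable [NeZero K] (hcd : ∀ t τ : ℕ, MeasurableSet
      {p : Ξ × (ℕ → Fin K) × (ℕ → ℝ) | c.cd p.1 t τ p.2.1 p.2.2})
include hcd

lemma measurable_run (t : ℕ) :
    Measurable fun p : Ξ × (ℕ → Fin K → ℝ) => run c p.1 p.2 t := by
  induction t with
  | zero => exact measurable_const
  | succ t ih =>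
    exact State.measurable_step hcd ih measurable_fst
      ((measurable_pi_apply (t + 1)).comp measurable_snd) (t + 1)

lemma measurable_armAt (t : ℕ) :
    Measurable fun p : Ξ × (ℕ → Fin K → ℝ) => armAt c p.1 p.2 t :=
  (State.measurable_arm_apply t).comp (measurable_run hcd t)

lemma measurableSet_run_tau (t : ℕ) :
    MeasurableSet {p : Ξ × (ℕ → Fin K → ℝ) | (run c p.1 p.2 t).tau = t} :=
  (State.measurable_tau.comp (measurable_run hcd t)) (measurableSet_singleton t)

lemma measurableSet_alarmTime_eq (T i s : ℕ) :
    MeasurableSet {p : Ξ × (ℕ → Fin K → ℝ) | alarmTime c p.1 p.2 T i = s} := by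
  induction i generalizing s with
  | zero => exact MeasurableSet.const ((0 : ℕ∞) = s)
  | succ i ih =>
    simp only [alarmTime_succ_eq_coe_iff]
    have : {p : Ξ × (ℕ → Fin K → ℝ) | ∃ r < s, alarmTime c p.1 p.2 T i = r ∧
        ∀ q, r < q → q < s → (run c p.1 p.2 q).tau ≠ q}
        = ⋃ r ∈ Finset.range s, {p | alarmTime c p.1 p.2 T i = r} ∩
          ⋂ q ∈ Finset.Ioo r s, {p | (run c p.1 p.2 q).tau = q}ᶜ := by
      ext p
      simp only [Set.mem_ofPred_eq, Set.mem_iUnion, Set.mem_inter_iff, Set.mem_iInter,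
        Finset.mem_range, Finset.mem_Ioo, Set.mem_compl_iff, exists_prop, and_imp, ne_eq]
    have hm : MeasurableSet {p : Ξ × (ℕ → Fin K → ℝ) | ∃ r < s, alarmTime c p.1 p.2 T i = r ∧
        ∀ q, r < q → q < s → (run c p.1 p.2 q).tau ≠ q} := by
      rw [this]
      exact Finset.measurableSet_biUnion _ fun r _ => (ih r).inter
        (Finset.measurableSet_biInter _ fun q _ => (measurableSet_run_tau hcd q).compl)
    exact (MeasurableSet.const (s ≤ T)).inter ((measurableSet_run_tau hcd s).inter hm)

lemma measurable_playCount (s t : ℕ) (k : Fin K) :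
    Measurable fun p : Ξ × (ℕ → Fin K → ℝ) => playCount c p.1 p.2 s t k := by
  simp only [playCount, Finset.card_filter]
  exact Finset.measurable_sum _ fun r _ => Measurable.ite
    ((measurable_armAt hcd r) (measurableSet_singleton k)) measurable_const measurable_const

lemma measurable_deviation (s t : ℕ) (k : Fin K) (m : ℝ) :
    Measurable fun p : Ξ × (ℕ → Fin K → ℝ) => deviation c p.1 p.2 s t k m := by
  simp only [deviation, Finset.sum_filter]
  exact Finset.measurable_sum _ fun r _ => Measurable.ite
    ((measurable_armAt hcd r) (measurableSet_singleton k))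
    (by fun_prop) measurable_const

lemma measurableSet_overEstimates (s t : ℕ) (k : Fin K) (m : ℝ) :
    MeasurableSet {p : Ξ × (ℕ → Fin K → ℝ) | OverEstimates c p.1 p.2 s t k m} := by
  have h := measurable_playCount hcd s (t - 1) k
  have h' : Measurable fun p : Ξ × (ℕ → Fin K → ℝ) => (playCount c p.1 p.2 s (t - 1) k : ℝ) :=
    (measurable_of_countable _).comp h
  exact (measurableSet_le measurable_const h).inter
    (measurableSet_le (((h'.const_mul 2).mul_const _).sqrt) (measurable_deviation hcd s _ k m))

lemma measurableSet_underEstimates (s t : ℕ) (k : Fin K) (m : ℝ) :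
    MeasurableSet {p : Ξ × (ℕ → Fin K → ℝ) | UnderEstimates c p.1 p.2 s t k m} := by
  have h := measurable_playCount hcd s (t - 1) k
  have h' : Measurable fun p : Ξ × (ℕ → Fin K → ℝ) => (playCount c p.1 p.2 s (t - 1) k : ℝ) :=
    (measurable_of_countable _).comp h
  exact (measurableSet_le measurable_const h).inter
    (measurableSet_le (measurable_deviation hcd s _ k m) ((h'.const_mul 2).mul_const _).sqrt.neg)

end Measurability

/-! ### The exponential weight of the centred rewards -/

section ExponentialWeight

variable {K : ℕ} {Ω Ξ : Type*}

/-- A function of the randomization and of the rewards that depends only on the rewards of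
`1, …, t`. -/
def NonAnticipating {β : Type*} (t : ℕ) (g : Ξ × (ℕ → Fin K → ℝ) → β) : Prop :=
  ∀ ξ x y, (∀ r, 1 ≤ r → r ≤ t → x r = y r) → g (ξ, x) = g (ξ, y)

/-- The randomization and the rewards. -/
def outcome (X : ℕ → Fin K → Ω → ℝ) (ξ : Ω → Ξ) (ω : Ω) : Ξ × (ℕ → Fin K → ℝ) :=
  (ξ ω, fun r k => X r k ω)

variable [NeZero K] {c : Config K Ξ}

lemma deviation_succ (p : Ξ × (ℕ → Fin K → ℝ)) {s t : ℕ} (hst : s ≤ t) (k : Fin K) (m : ℝ) :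
    deviation c p.1 p.2 s (t + 1) k m = deviation c p.1 p.2 s t k m
      + if armAt c p.1 p.2 (t + 1) = k then p.2 (t + 1) k - m else 0 := by
  simp only [deviation, Finset.sum_filter]
  rw [Finset.sum_Ioc_succ_top hst]

lemma playCount_succ (p : Ξ × (ℕ → Fin K → ℝ)) {s t : ℕ} (hst : s ≤ t) (k : Fin K) :
    playCount c p.1 p.2 s (t + 1) k = playCount c p.1 p.2 s t k
      + if armAt c p.1 p.2 (t + 1) = k then 1 else 0 :=
  card_filter_Ioc_succ _ hst

/-- The exponential supermartingale of the centred rewards of arm `k` after `s`. -/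
noncomputable def expWeight (c : Config K Ξ) (s t : ℕ) (k : Fin K) (m l : ℝ)
    (p : Ξ × (ℕ → Fin K → ℝ)) : ENNReal :=
  ENNReal.ofReal (Real.exp
    (l * deviation c p.1 p.2 s t k m - l ^ 2 / 8 * playCount c p.1 p.2 s t k))

lemma expWeight_self (s : ℕ) (k : Fin K) (m l : ℝ) (p : Ξ × (ℕ → Fin K → ℝ)) :
    expWeight c s s k m l p = 1 := by
  simp [expWeight, deviation, playCount]

lemma expWeight_succ {s t : ℕ} (hst : s ≤ t) (k : Fin K) (m l : ℝ)
    (p : Ξ × (ℕ → Fin K → ℝ)) :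
    expWeight c s (t + 1) k m l p = expWeight c s t k m l p *
      if armAt c p.1 p.2 (t + 1) = k then
        ENNReal.ofReal (Real.exp (l * (p.2 (t + 1) k - m) - l ^ 2 / 8)) else 1 := by
  simp only [expWeight, deviation_succ p hst, playCount_succ p hst]
  split_ifs
  · rw [← ENNReal.ofReal_mul (Real.exp_pos _).le, ← Real.exp_add]
    congr 2
    push_cast
    ring
  · simp

lemma nonAnticipating_expWeight (s t : ℕ) (k : Fin K) (m l : ℝ) :
    NonAnticipating t (expWeight c s t k m l) := by
  intro ξ x y h
  have harm : ∀ r ∈ Finset.Ioc s t, armAt c ξ x r = armAt c ξ y r := fun r hr =>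
    armAt_congr c ξ fun q h1 h2 => h q h1 (by rw [Finset.mem_Ioc] at hr; omega)
  have hf : (Finset.Ioc s t).filter (fun r => armAt c ξ x r = k)
      = (Finset.Ioc s t).filter (fun r => armAt c ξ y r = k) :=
    Finset.filter_congr fun r hr => by rw [harm r hr]
  simp only [expWeight, deviation, playCount, hf]
  congr 4
  refine Finset.sum_congr rfl fun r hr => ?_
  have := Finset.mem_Ioc.1 (Finset.mem_filter.1 hr).1
  rw [h r (by omega) this.2]

end ExponentialWeight

/-! ### Independence of past and present, and Hoeffding's lemma -/

section Probability

/-- If `U` is independent of `(Y, Z)`, and `Y` of `Z`, then `(U, Y)` is independent of `Z`. -/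
lemma indepFun_prodMk_of_indepFun_prodMk {Ω α β γ : Type*} [MeasurableSpace Ω]
    [MeasurableSpace α] [MeasurableSpace β] [MeasurableSpace γ] {P : Measure Ω}
    [IsProbabilityMeasure P] {U : Ω → α} {Y : Ω → β} {Z : Ω → γ} (hU : Measurable U)
    (hY : Measurable Y) (hZ : Measurable Z) (h1 : IndepFun U (fun ω => (Y ω, Z ω)) P)
    (h2 : IndepFun Y Z P) : IndepFun (fun ω => (U ω, Y ω)) Z P := by
  have h3 : IndepFun U Y P := h1.comp measurable_id measurable_fst
  have hYZ := (hY.prodMk hZ)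
  rw [indepFun_iff_map_prod_eq_prod_map_map hU.aemeasurable hYZ.aemeasurable] at h1
  rw [indepFun_iff_map_prod_eq_prod_map_map hY.aemeasurable hZ.aemeasurable] at h2
  rw [indepFun_iff_map_prod_eq_prod_map_map hU.aemeasurable hY.aemeasurable] at h3
  rw [indepFun_iff_map_prod_eq_prod_map_map (hU.prodMk hY).aemeasurable hZ.aemeasurable]
  have := Measure.isProbabilityMeasure_map (μ := P) hU.aemeasurable
  have := Measure.isProbabilityMeasure_map (μ := P) hY.aemeasurable
  have := Measure.isProbabilityMeasure_map (μ := P) hZ.aemeasurable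
  have e : (fun ω => ((U ω, Y ω), Z ω))
      = MeasurableEquiv.prodAssoc.symm ∘ fun ω => (U ω, (Y ω, Z ω)) := rfl
  rw [h3, e, ← Measure.map_map (MeasurableEquiv.measurable _) (hU.prodMk hYZ), h1, h2,
    ← Measure.prodAssoc_prod, Measure.map_map (MeasurableEquiv.measurable _)
      (MeasurableEquiv.measurable _)]
  simp

variable {K : ℕ} {Ω Ξ : Type*} [MeasurableSpace Ω] [MeasurableSpace Ξ]

/-- The data of the problem: independent reward vectors on `1, …, T` with values in `[0, 1]`, and
a randomization independent of them. -/
structure IsEnvironment (P : Measure Ω) (f : ℕ → Fin K → Measure ℝ) (X : ℕ → Fin K → Ω → ℝ)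
    (ξ : Ω → Ξ) (T : ℕ) : Prop where
  measurable : ∀ t k, Measurable (X t k)
  law : ∀ t ∈ Finset.Icc 1 T, ∀ k, P.map (X t k) = f t k
  bounded : ∀ t ∈ Finset.Icc 1 T, ∀ k, ∀ᵐ x ∂(f t k), x ∈ Set.Icc (0 : ℝ) 1
  indep : iIndepFun (fun (t : Finset.Icc 1 T) (ω : Ω) (k : Fin K) => X t k ω) P
  measurable_randomization : Measurable ξ
  indep_randomization : IndepFun ξ (fun (ω : Ω) (t : Finset.Icc 1 T) (k : Fin K) => X t k ω) P

variable {P : Measure Ω} [IsProbabilityMeasure P] {f : ℕ → Fin K → Measure ℝ}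
  {X : ℕ → Fin K → Ω → ℝ} {ξ : Ω → Ξ} {T : ℕ}

namespace IsEnvironment

variable (env : IsEnvironment P f X ξ T)
include env

omit [IsProbabilityMeasure P] in
lemma measurable_reward (t : ℕ) : Measurable fun ω k => X t k ω :=
  measurable_pi_iff.2 (env.measurable t)

omit [IsProbabilityMeasure P] in
lemma measurable_outcome : Measurable (outcome X ξ) :=
  env.measurable_randomization.prodMk (measurable_pi_iff.2 env.measurable_reward)

/-- Rewards outside `1, …, t` are set to 0 so that the history is a function of `ξ` and of finitely
many vectors of the independent family. A non-anticipating function cannot see the change. -/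
lemma indepFun_history {t : ℕ} (ht : t + 1 ∈ Finset.Icc 1 T) :
    IndepFun (fun ω => (ξ ω, fun (r : ℕ) (k : Fin K) => if 1 ≤ r ∧ r ≤ t then X r k ω else 0))
      (fun ω k => X (t + 1) k ω) P := by
  have htT := (Finset.mem_Icc.1 ht).2
  have hmem : ∀ r, 1 ≤ r ∧ r ≤ t → r ∈ Finset.Icc 1 T := fun r h => by
    rw [Finset.mem_Icc]; omega
  have hpast : Measurable fun (ω : Ω) (r : ℕ) (k : Fin K) =>
      if 1 ≤ r ∧ r ≤ t then X r k ω else 0 := by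
    refine measurable_pi_iff.2 fun r => measurable_pi_iff.2 fun k => ?_
    split_ifs
    · exact env.measurable r k
    · exact measurable_const
  refine indepFun_prodMk_of_indepFun_prodMk env.measurable_randomization hpast
    (env.measurable_reward (t + 1)) ?_ ?_
  · let χ : ((s : Finset.Icc 1 T) → Fin K → ℝ) → (ℕ → Fin K → ℝ) × (Fin K → ℝ) := fun y =>
      (fun r k => if h : 1 ≤ r ∧ r ≤ t then y ⟨r, hmem r h⟩ k else 0, y ⟨t + 1, ht⟩)
    have hχ : Measurable χ := by
      refine Measurable.prodMk (measurable_pi_iff.2 fun r => measurable_pi_iff.2 fun k => ?_)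
        (measurable_pi_apply _)
      split_ifs
      · fun_prop
      · exact measurable_const
    exact env.indep_randomization.comp measurable_id hχ
  · let S : Finset (Finset.Icc 1 T) := Finset.univ.filter fun r => (r : ℕ) ≤ t
    let S' : Finset (Finset.Icc 1 T) := {⟨t + 1, ht⟩}
    have hd : Disjoint S S' := by
      rw [Finset.disjoint_singleton_right]
      simp [S]
    let φ : ((s : S) → Fin K → ℝ) → (ℕ → Fin K → ℝ) := fun y r k =>
      if h : 1 ≤ r ∧ r ≤ t then
        y ⟨⟨r, hmem r h⟩, Finset.mem_filter.2 ⟨Finset.mem_univ _, h.2⟩⟩ k else 0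
    have hφ : Measurable φ := by
      refine measurable_pi_iff.2 fun r => measurable_pi_iff.2 fun k => ?_
      simp only [φ]
      split_ifs
      · fun_prop
      · exact measurable_const
    exact (env.indep.indepFun_finset S S' hd fun i => env.measurable_reward i).comp hφ
      (measurable_pi_apply (⟨⟨t + 1, ht⟩, Finset.mem_singleton_self _⟩ : S'))

lemma indepFun_of_nonAnticipating {β : Type*} [MeasurableSpace β] {t : ℕ}
    (ht : t + 1 ∈ Finset.Icc 1 T) {g : Ξ × (ℕ → Fin K → ℝ) → β} (hg : Measurable g)
    (hna : NonAnticipating t g) :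
    IndepFun (fun ω => g (outcome X ξ ω)) (fun ω k => X (t + 1) k ω) P := by
  convert (env.indepFun_history ht).comp hg measurable_id using 1
  swap
  · rfl
  funext ω
  refine hna _ _ _ fun r h1 h2 => ?_
  funext k
  simp [h1, h2]

omit [IsProbabilityMeasure P] in
lemma integral_law {t : ℕ} (ht : t ∈ Finset.Icc 1 T) (k : Fin K) :
    ∫ x, x ∂(f t k) = ∫ ω, X t k ω ∂P := by
  rw [← env.law t ht k, integral_map (env.measurable t k).aemeasurable
    measurable_id'.aestronglyMeasurable]

omit [IsProbabilityMeasure P] in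
lemma reward_mem_Icc {t : ℕ} (ht : t ∈ Finset.Icc 1 T) (k : Fin K) :
    ∀ᵐ ω ∂P, X t k ω ∈ Set.Icc (0 : ℝ) 1 := by
  have := env.bounded t ht k
  rw [← env.law t ht k] at this
  exact ae_of_ae_map (env.measurable t k).aemeasurable this

/-- Hoeffding's lemma: a variable in `[0, 1]` is sub-Gaussian with variance proxy `1/4`, hence the
compensator `l²/8`. -/
lemma lintegral_exp_le {t : ℕ} (ht : t ∈ Finset.Icc 1 T) (k : Fin K) {m : ℝ}
    (hm : ∫ x, x ∂(f t k) = m) (l : ℝ) :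
    ∫⁻ ω, ENNReal.ofReal (Real.exp (l * (X t k ω - m) - l ^ 2 / 8)) ∂P ≤ 1 := by
  have h := hasSubgaussianMGF_of_mem_Icc (env.measurable t k).aemeasurable
    (env.reward_mem_Icc ht k)
  rw [← env.integral_law ht k, hm] at h
  have h1 := h.integrable_exp_mul l
  have h2 := h.mgf_le l
  simp only [Real.exp_sub, div_eq_mul_inv (Real.exp (l * _))]
  rw [← ofReal_integral_eq_lintegral_ofReal (h1.mul_const _)
    (Filter.Eventually.of_forall fun ω => by positivity), integral_mul_const]
  refine ENNReal.ofReal_le_one.2 ?_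
  rw [← div_eq_mul_inv, div_le_one (Real.exp_pos _)]
  refine h2.trans (le_of_eq ?_)
  norm_num
  ring

end IsEnvironment

variable [NeZero K] {c : Config K Ξ}

/-! ### Concentration at adaptive sample counts -/

section Concentration

variable (env : IsEnvironment P f X ξ T)
  (hcd : ∀ t τ : ℕ, MeasurableSet
      {p : Ξ × (ℕ → Fin K) × (ℕ → ℝ) | c.cd p.1 t τ p.2.1 p.2.2})

include hcd in
omit [MeasurableSpace Ω] in
lemma measurable_expWeight (s t : ℕ) (k : Fin K) (m l : ℝ) :
    Measurable (expWeight c s t k m l) := by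
  have h1 := measurable_deviation hcd s t k m
  have h2 : Measurable fun p : Ξ × (ℕ → Fin K → ℝ) => (playCount c p.1 p.2 s t k : ℝ) :=
    (measurable_of_countable _).comp (measurable_playCount hcd s t k)
  exact (((h1.const_mul l).sub (h2.const_mul _)).exp).ennreal_ofReal

variable {s : ℕ} {B : Set (Ξ × (ℕ → Fin K → ℝ))} (hB : MeasurableSet B)
  (hBs : NonAnticipating s fun p => p ∈ B) (k : Fin K) {m : ℝ}
include env hcd hB hBs

/-- Supermartingale step: a round that skips `k` leaves the weight unchanged, and a round that plays
`k` multiplies it by a factor independent of the past with mean at most 1. Being decided by time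
`s`, `B` belongs to the past of every round; it will be `{τ_{i-1} = s}`. -/
lemma lintegral_expWeight_le (l : ℝ) {t : ℕ} (hst : s ≤ t) (htT : t ≤ T)
    (hm : ∀ r ∈ Finset.Ioc s t, ∫ x, x ∂(f r k) = m) :
    ∫⁻ ω, B.indicator (expWeight c s t k m l) (outcome X ξ ω) ∂P ≤ P (outcome X ξ ⁻¹' B) := by
  have hO := env.measurable_outcome
  induction t, hst using Nat.le_induction with
  | base =>
    have : ∀ ω, B.indicator (expWeight c s s k m l) (outcome X ξ ω)
        = (outcome X ξ ⁻¹' B).indicator 1 ω := fun ω => by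
      simp only [Set.indicator, expWeight_self, Pi.one_apply]
      rfl
    simp only [this]
    rw [lintegral_indicator_one (hO hB)]
  | succ t hst ih =>
    refine le_trans ?_ (ih (by omega) fun r hr => hm r (by rw [Finset.mem_Ioc] at *; omega))
    have ht : t + 1 ∈ Finset.Icc 1 T := by rw [Finset.mem_Icc]; omega
    set A : Set (Ξ × (ℕ → Fin K → ℝ)) := {p | armAt c p.1 p.2 (t + 1) = k} with hA
    have hAm : MeasurableSet A := (measurable_armAt hcd (t + 1)) (measurableSet_singleton k)
    set G := B.indicator (expWeight c s t k m l) with hG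
    have hGm : Measurable G := (measurable_expWeight hcd s t k m l).indicator hB
    have hGA : NonAnticipating t (A.indicator G) := by
      intro ξ' x y h
      have h1 := nonAnticipating_expWeight (c := c) s t k m l ξ' x y h
      have h2 : ((ξ', x) ∈ B) = ((ξ', y) ∈ B) := hBs ξ' x y fun r h1 h2 => h r h1 (by omega)
      have h3 : ((ξ', x) ∈ A) = ((ξ', y) ∈ A) := by
        simp only [hA, Set.mem_ofPred_eq]
        rw [armAt_congr c ξ' fun r h1 h2 => h r h1 (by omega)]
      classical
      simp only [Set.indicator_apply, hG, h1, h2, h3]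
    have hφ : Measurable fun y : Fin K → ℝ =>
        ENNReal.ofReal (Real.exp (l * (y k - m) - l ^ 2 / 8)) := by fun_prop
    have hind := (env.indepFun_of_nonAnticipating ht (hGm.indicator hAm) hGA).comp
      measurable_id hφ
    have hsplit : ∀ ω, B.indicator (expWeight c s (t + 1) k m l) (outcome X ξ ω)
        = (Aᶜ).indicator G (outcome X ξ ω) + A.indicator G (outcome X ξ ω) *
          ENNReal.ofReal (Real.exp (l * (X (t + 1) k ω - m) - l ^ 2 / 8)) := by
      intro ω
      classical
      simp only [Set.indicator_apply, hG, expWeight_succ hst, hA, Set.mem_compl_iff,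
        Set.mem_ofPred_eq]
      split_ifs <;> simp_all [outcome]
    simp only [hsplit]
    have hG1 : Measurable fun ω => (Aᶜ).indicator G (outcome X ξ ω) :=
      (hGm.indicator hAm.compl).comp hO
    have hG2 : Measurable fun ω => A.indicator G (outcome X ξ ω) := (hGm.indicator hAm).comp hO
    rw [lintegral_add_left hG1]
    have hprod := lintegral_mul_eq_lintegral_mul_lintegral_of_indepFun hG2
      (hφ.comp (env.measurable_reward (t + 1))) hind
    simp only [Pi.mul_apply, Function.comp_apply] at hprod
    rw [hprod]
    have hle := env.lintegral_exp_le ht k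
      (hm (t + 1) (by rw [Finset.mem_Ioc]; omega)) l
    calc _ ≤ ∫⁻ ω, (Aᶜ).indicator G (outcome X ξ ω) ∂P
          + (∫⁻ ω, A.indicator G (outcome X ξ ω) ∂P) * 1 := by gcongr
      _ = ∫⁻ ω, G (outcome X ξ ω) ∂P := by
        rw [mul_one, ← lintegral_add_left hG1]
        refine lintegral_congr fun ω => ?_
        classical
        simp only [Set.indicator_apply, Set.mem_compl_iff]
        split_ifs <;> simp_all

/-- Chernoff's bound for both tails, `σ = 1` and `σ = -1`. Fixing the count at `n` makes the
compensator deterministic. -/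
lemma measure_deviation_ge_le {t n : ℕ} (hst : s ≤ t) (htT : t ≤ T) (hn : 1 ≤ n)
    (hm : ∀ r ∈ Finset.Ioc s t, ∫ x, x ∂(f r k) = m) {L : ℝ} (hL : 0 ≤ L) {σ : ℝ}
    (hσ : σ ^ 2 = 1) :
    P.real {ω | outcome X ξ ω ∈ B ∧ playCount c (ξ ω) (fun r k => X r k ω) s t k = n ∧
      Real.sqrt (2 * n * L) ≤ σ * deviation c (ξ ω) (fun r k => X r k ω) s t k m}
      ≤ P.real (outcome X ξ ⁻¹' B) * Real.exp (-(4 * L)) := by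
  have hn' : (0 : ℝ) < n := by exact_mod_cast hn
  -- For `a = √(2nL)`, the exponent `λa - λ²n/8` is maximal at `λ = 4a/n`, with value `2a²/n = 4L`.
  set l : ℝ := σ * (4 * Real.sqrt (2 * n * L) / n) with hl
  have hl2 : l ^ 2 / 8 * n = 4 * L := by
    rw [hl, mul_pow, hσ, div_pow, mul_pow, Real.sq_sqrt (by positivity)]
    field_simp
    ring
  have hG : Measurable fun ω => B.indicator (expWeight c s t k m l) (outcome X ξ ω) :=
    ((measurable_expWeight hcd s t k m l).indicator hB).comp env.measurable_outcome
  have hmark := (mul_meas_ge_le_lintegral (μ := P) hG (ENNReal.ofReal (Real.exp (4 * L)))).trans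
    (lintegral_expWeight_le env hcd hB hBs k l hst htT hm)
  have hsub : {ω | outcome X ξ ω ∈ B ∧ playCount c (ξ ω) (fun r k => X r k ω) s t k = n ∧
      Real.sqrt (2 * n * L) ≤ σ * deviation c (ξ ω) (fun r k => X r k ω) s t k m}
      ⊆ {ω | ENNReal.ofReal (Real.exp (4 * L))
        ≤ B.indicator (expWeight c s t k m l) (outcome X ξ ω)} := by
    rintro ω ⟨h1, h2, h3⟩
    simp only [Set.mem_ofPred_eq]
    rw [Set.indicator_of_mem h1, expWeight]
    refine ENNReal.ofReal_le_ofReal (Real.exp_le_exp.2 ?_)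
    simp only [outcome, h2]
    rw [hl2]
    have h4 : 8 * L ≤ l * deviation c (ξ ω) (fun r k => X r k ω) s t k m := by
      calc 8 * L = 4 * Real.sqrt (2 * n * L) / n * Real.sqrt (2 * n * L) := by
            rw [div_mul_eq_mul_div, mul_assoc, Real.mul_self_sqrt (by positivity)]
            field_simp
            ring
        _ ≤ 4 * Real.sqrt (2 * n * L) / n *
            (σ * deviation c (ξ ω) (fun r k => X r k ω) s t k m) := by gcongr
        _ = _ := by rw [hl]; ring
    linarith
  have h5 := (mul_le_mul_right (measure_mono hsub) (ENNReal.ofReal (Real.exp (4 * L)))).trans hmark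
  have h6 := ENNReal.toReal_mono (measure_ne_top P _) h5
  rw [ENNReal.toReal_mul, ENNReal.toReal_ofReal (Real.exp_pos _).le] at h6
  rw [Real.exp_neg, ← div_eq_mul_inv, le_div_iff₀ (Real.exp_pos _), mul_comm]
  exact h6

/-- Union bound over the random count: with `d = t - s`, fewer than `d` values occur, each with
factor `exp (-4 log d) = d⁻⁴`, and `d · d⁻⁴ ≤ d⁻²`. -/
lemma measure_playCount_deviation_le {t : ℕ} (hst : s < t) (htT : t ≤ T)
    (hm : ∀ r ∈ Finset.Ioc s t, ∫ x, x ∂(f r k) = m) {σ : ℝ} (hσ : σ ^ 2 = 1) :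
    P.real {ω | outcome X ξ ω ∈ B ∧ 1 ≤ playCount c (ξ ω) (fun r k => X r k ω) s (t - 1) k ∧
      Real.sqrt (2 * playCount c (ξ ω) (fun r k => X r k ω) s (t - 1) k * Real.log (t - s : ℕ))
        ≤ σ * deviation c (ξ ω) (fun r k => X r k ω) s (t - 1) k m}
      ≤ P.real (outcome X ξ ⁻¹' B) * (1 / ((t - s : ℕ) : ℝ) ^ 2) := by
  have hd : (1 : ℝ) ≤ (t - s : ℕ) := by exact_mod_cast (by omega : 1 ≤ t - s)
  have hsub : {ω | outcome X ξ ω ∈ B ∧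
      1 ≤ playCount c (ξ ω) (fun r k => X r k ω) s (t - 1) k ∧
      Real.sqrt (2 * playCount c (ξ ω) (fun r k => X r k ω) s (t - 1) k * Real.log (t - s : ℕ))
        ≤ σ * deviation c (ξ ω) (fun r k => X r k ω) s (t - 1) k m}
      ⊆ ⋃ n ∈ Finset.Icc 1 (t - 1 - s), {ω | outcome X ξ ω ∈ B ∧
        playCount c (ξ ω) (fun r k => X r k ω) s (t - 1) k = n ∧
        Real.sqrt (2 * n * Real.log (t - s : ℕ))
          ≤ σ * deviation c (ξ ω) (fun r k => X r k ω) s (t - 1) k m} := by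
    rintro ω ⟨h1, h2, h3⟩
    simp only [Set.mem_iUnion]
    refine ⟨_, Finset.mem_Icc.2 ⟨h2, ?_⟩, h1, rfl, h3⟩
    exact (Finset.card_filter_le _ _).trans (Nat.card_Ioc _ _).le
  refine (measureReal_mono hsub (measure_ne_top P _)).trans ((measureReal_biUnion_finset_le _ _).trans ?_)
  refine (Finset.sum_le_sum fun n hn => measure_deviation_ge_le env hcd hB hBs k
    (by omega) (by omega) (Finset.mem_Icc.1 hn).1
    (fun r hr => hm r (by rw [Finset.mem_Ioc] at *; omega))
    (Real.log_natCast_nonneg _) hσ).trans ?_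
  rw [Finset.sum_const, Nat.card_Icc, nsmul_eq_mul, mul_left_comm]
  gcongr
  have he : Real.exp (-(4 * Real.log (t - s : ℕ))) = 1 / ((t - s : ℕ) : ℝ) ^ 4 := by
    rw [Real.exp_neg, mul_comm, Real.exp_mul, Real.exp_log (by linarith), one_div]
    norm_cast
  have hc : ((t - 1 - s + 1 - 1 : ℕ) : ℝ) ≤ (t - s : ℕ) := by
    exact_mod_cast (by omega)
  rw [he, mul_one_div, div_le_div_iff₀ (by positivity) (by positivity)]
  set d : ℝ := ((t - s : ℕ) : ℝ)
  calc _ ≤ d * d ^ 2 := by gcongr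
    _ ≤ 1 * d ^ 4 := by nlinarith [pow_pos (by linarith : 0 < d) 3]

lemma measure_overEstimates_le {t : ℕ} (hst : s < t) (htT : t ≤ T)
    (hm : ∀ r ∈ Finset.Ioc s t, ∫ x, x ∂(f r k) = m) :
    P.real {ω | outcome X ξ ω ∈ B ∧ OverEstimates c (ξ ω) (fun r k => X r k ω) s t k m}
      ≤ P.real (outcome X ξ ⁻¹' B) * (1 / ((t - s : ℕ) : ℝ) ^ 2) := by
  refine le_trans (measureReal_mono ?_)
    (measure_playCount_deviation_le env hcd hB hBs k hst htT hm (one_pow 2))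
  rintro ω ⟨h1, h2, h3⟩
  exact ⟨h1, h2, by rwa [one_mul]⟩

lemma measure_underEstimates_le {t : ℕ} (hst : s < t) (htT : t ≤ T)
    (hm : ∀ r ∈ Finset.Ioc s t, ∫ x, x ∂(f r k) = m) :
    P.real {ω | outcome X ξ ω ∈ B ∧ UnderEstimates c (ξ ω) (fun r k => X r k ω) s t k m}
      ≤ P.real (outcome X ξ ⁻¹' B) * (1 / ((t - s : ℕ) : ℝ) ^ 2) := by
  refine le_trans (measureReal_mono ?_)
    (measure_playCount_deviation_le env hcd hB hBs k hst htT hm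
      (by norm_num : (-1 : ℝ) ^ 2 = 1))
  rintro ω ⟨h1, h2, h3⟩
  exact ⟨h1, h2, by linarith⟩

end Concentration

end Probability

/-! ### Stationary segments and their lengths -/

section Segments

variable {K : ℕ} (f : ℕ → Fin K → Measure ℝ) (T : ℕ)

lemma finite_isChange : (Set.ofPred (IsChange f T)).Finite :=
  (Set.finite_Icc 1 T).subset fun t ht => ⟨ht.1, by have := ht.2.1; omega⟩

lemma card_isChange : (finite_isChange f T).toFinset.card = numSegments f T - 1 := by
  classical
  rw [numSegments, Nat.add_sub_cancel_left]
  congr 1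
  ext t
  simp only [Set.Finite.mem_toFinset, Set.mem_ofPred_eq, Finset.mem_filter, Finset.mem_Icc]
  refine ⟨fun h => ⟨⟨h.1, ?_⟩, ?_⟩, fun h => ?_⟩
  · have := h.2.1; omega
  · exact h
  · exact h.2

lemma one_le_numSegments : 1 ≤ numSegments f T := Nat.le_add_right _ _

lemma changeTime_zero : changeTime f T 0 = 0 := rfl

lemma changeTime_numSegments : changeTime f T (numSegments f T) = T := by
  have := one_le_numSegments f T
  rw [changeTime, if_neg (by omega), if_neg (lt_irrefl _)]

variable {f T}

lemma changeTime_of_lt {i : ℕ} (h1 : 1 ≤ i) (h2 : i < numSegments f T) :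
    changeTime f T i = Nat.nth (IsChange f T) (i - 1) := by
  rw [changeTime, if_neg (by omega), if_pos h2]

lemma isChange_changeTime {i : ℕ} (h1 : 1 ≤ i) (h2 : i < numSegments f T) :
    IsChange f T (changeTime f T i) := by
  rw [changeTime_of_lt h1 h2]
  exact Nat.nth_mem_of_lt_card (finite_isChange f T) (by rw [card_isChange]; omega)

lemma changeTime_le (i : ℕ) : changeTime f T i ≤ T := by
  rcases Nat.eq_zero_or_pos i with rfl | hi
  · exact Nat.zero_le _
  · by_cases h : i < numSegments f T
    · have := (isChange_changeTime hi h).2.1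
      omega
    · rw [changeTime, if_neg (by omega), if_neg h]

lemma changeTime_pred_le {i : ℕ} (h1 : 1 ≤ i) (h2 : i ≤ numSegments f T) :
    changeTime f T (i - 1) ≤ changeTime f T i := by
  rcases h2.lt_or_eq with h | h
  · by_cases hi : i = 1
    · subst hi; exact Nat.zero_le _
    · rw [changeTime_of_lt h1 h, changeTime_of_lt (by omega) (by omega)]
      refine (Nat.nth_strictMonoOn (finite_isChange f T)).monotoneOn ?_ ?_ (by omega) <;>
        rw [Set.mem_Iio, card_isChange] <;> omega
  · rw [h, changeTime_numSegments]
    exact changeTime_le _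

lemma not_isChange_of_mem_segment {i t : ℕ} (h1 : 1 ≤ i) (h2 : i ≤ numSegments f T)
    (hl : changeTime f T (i - 1) < t) (hu : t < changeTime f T i) : ¬ IsChange f T t := by
  intro hp
  obtain ⟨n, hn, rfl⟩ := Nat.exists_lt_card_finite_nth_eq (finite_isChange f T) hp
  have hmono := (Nat.nth_strictMonoOn (finite_isChange f T)).monotoneOn
  rw [card_isChange] at hn hmono
  by_cases hni : n + 1 < i
  · rw [changeTime_of_lt (by omega) (by omega)] at hl
    exact absurd hl (not_lt.2 (hmono (by rw [Set.mem_Iio]; omega) (by rw [Set.mem_Iio]; omega)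
      (by omega)))
  · rw [changeTime_of_lt h1 (by omega)] at hu
    exact absurd hu (not_lt.2 (hmono (by rw [Set.mem_Iio]; omega) (by rw [Set.mem_Iio]; omega)
      (by omega)))

/-- The laws are constant on a segment. -/
lemma law_eq_of_mem_segment {i t : ℕ} (h1 : 1 ≤ i) (h2 : i ≤ numSegments f T)
    (ht : t ∈ Finset.Ioc (changeTime f T (i - 1)) (changeTime f T i)) (k : Fin K) :
    f t k = f (changeTime f T (i - 1) + 1) k := by
  obtain ⟨hl, hu⟩ := Finset.mem_Ioc.1 ht
  clear ht
  induction t, Nat.succ_le_of_lt hl using Nat.le_induction with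
  | base => rfl
  | succ t hlt ih =>
    rw [← ih (by omega) (by omega)]
    by_contra hne
    have := changeTime_le (f := f) (T := T) i
    exact not_isChange_of_mem_segment h1 h2 (by omega) (by omega : t < changeTime f T i)
      ⟨by omega, by omega, k, fun h => hne h.symm⟩

lemma segMean_eq {i t : ℕ} (h1 : 1 ≤ i) (h2 : i ≤ numSegments f T)
    (ht : t ∈ Finset.Ioc (changeTime f T (i - 1)) (changeTime f T i)) (k : Fin K) :
    segMean f T i k = ∫ x, x ∂(f t k) := by
  rw [law_eq_of_mem_segment h1 h2 ht, segMean]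

lemma sum_segments {β : Type*} [AddCommMonoid β] (g : ℕ → β) :
    ∑ i ∈ Finset.Icc 1 (numSegments f T),
      ∑ t ∈ Finset.Ioc (changeTime f T (i - 1)) (changeTime f T i), g t
      = ∑ t ∈ Finset.Icc 1 T, g t := by
  have key : ∀ n ≤ numSegments f T, ∑ i ∈ Finset.Icc 1 n,
      ∑ t ∈ Finset.Ioc (changeTime f T (i - 1)) (changeTime f T i), g t
      = ∑ t ∈ Finset.Ioc 0 (changeTime f T n), g t := by
    intro n hn
    induction n with
    | zero => simp [changeTime_zero]
    | succ n ih =>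
      have hle : changeTime f T n ≤ changeTime f T (n + 1) :=
        changeTime_pred_le (i := n + 1) (by omega) hn
      rw [Finset.sum_Icc_succ_top (by omega), ih (by omega), Nat.add_sub_cancel,
        Finset.sum_Ioc_consecutive g (Nat.zero_le _) hle]
  rw [key _ le_rfl, changeTime_numSegments]
  rfl

lemma sum_segment_lengths :
    ∑ i ∈ Finset.Icc 1 (numSegments f T), (changeTime f T i - changeTime f T (i - 1)) = T := by
  have := sum_segments (f := f) (T := T) fun _ => 1
  simpa using this

/-- Cauchy–Schwarz for `M` segments whose lengths add up to `T`. -/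
lemma sum_sqrt_segment_lengths_le :
    ∑ i ∈ Finset.Icc 1 (numSegments f T),
      Real.sqrt (changeTime f T i - changeTime f T (i - 1) : ℕ)
      ≤ Real.sqrt (numSegments f T * T) := by
  refine Real.le_sqrt_of_sq_le (sq_sum_le_card_mul_sum_sq.trans (le_of_eq ?_))
  rw [Nat.card_Icc, Nat.add_sub_cancel]
  congr 1
  simp only [Real.sq_sqrt (Nat.cast_nonneg _)]
  exact_mod_cast sum_segment_lengths (f := f) (T := T)

lemma exists_segMean_eq_iSup [NeZero K] (i : ℕ) : ∃ j, segMean f T i j = ⨆ j, segMean f T i j :=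
  exists_eq_ciSup_of_finite

lemma gap_nonneg (i : ℕ) (k : Fin K) : 0 ≤ gap f T i k :=
  sub_nonneg.2 (le_ciSup (Set.finite_range _).bddAbove k)

/-- The expected loss of playing arm `k` in round `t`. -/
noncomputable def loss {K : ℕ} (f : ℕ → Fin K → Measure ℝ) (t : ℕ) (k : Fin K) : ℝ :=
  (⨆ j, ∫ x, x ∂(f t j)) - ∫ x, x ∂(f t k)

lemma loss_eq_gap {i t : ℕ} (h1 : 1 ≤ i) (h2 : i ≤ numSegments f T)
    (ht : t ∈ Finset.Ioc (changeTime f T (i - 1)) (changeTime f T i)) (k : Fin K) :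
    loss f t k = gap f T i k := by
  simp only [loss, gap, segMean_eq h1 h2 ht]

lemma loss_le_one [NeZero K] {t : ℕ} (hm : ∀ k, ∫ x, x ∂(f t k) ∈ Set.Icc (0 : ℝ) 1) (k : Fin K) :
    loss f t k ≤ 1 := by
  have : (⨆ j, ∫ x, x ∂(f t j)) ≤ 1 := ciSup_le fun j => (hm j).2
  have := (hm k).1
  rw [loss]
  linarith

/-! ### Loss within one segment -/

section EpochRegret

variable [NeZero K] {Ξ : Type*} (c : Config K Ξ) (ξ : Ξ) (x : ℕ → Fin K → ℝ)

lemma sum_apply_armAt (s e : ℕ) (g : Fin K → ℝ) :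
    ∑ t ∈ Finset.Ioc s e, g (armAt c ξ x t) = ∑ k, g k * playCount c ξ x s e k := by
  rw [← Finset.sum_fiberwise (Finset.Ioc s e) (fun t => armAt c ξ x t)]
  refine Finset.sum_congr rfl fun k _ => ?_
  rw [playCount, mul_comm, ← nsmul_eq_mul, ← Finset.sum_const]
  exact Finset.sum_congr rfl fun t ht => by rw [(Finset.mem_filter.1 ht).2]

variable (f T) in
open Classical in
/-- The number of rounds of the epoch started at `s` in which the index of arm `k` is too large or
that of arm `j` too small, in segment `i`. -/
noncomputable def misestimates (i : ℕ) (s : ℕ) (j k : Fin K) : ℝ :=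
  ∑ t ∈ Finset.Ioc s (changeTime f T i),
    ((if OverEstimates c ξ x s t k (segMean f T i k) then 1 else 0)
      + if UnderEstimates c ξ x s t j (segMean f T i j) then 1 else 0)

lemma misestimates_nonneg (i s : ℕ) (j k : Fin K) : 0 ≤ misestimates f T c ξ x i s j k := by
  unfold misestimates
  positivity

/-- Multiplying the play count by the gap turns `log T / Δ²` into `log T / Δ`. The term `2Δ`
collects the two additive ones, from low-count and from forced plays. For a zero gap both sides
vanish. -/
lemma gap_mul_playCount_le (hα : 0 < c.α)
    (htie : ∀ S : Finset (Fin K), S.Nonempty → c.tie S ∈ S) {i s : ℕ} {j : Fin K}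
    (hj : segMean f T i j = ⨆ j, segMean f T i j) (hse : s ≤ changeTime f T i)
    (hs : ∀ t, s ≤ t → t < changeTime f T i → (run c ξ x t).tau = s) (k : Fin K) :
    gap f T i k * playCount c ξ x s (changeTime f T i) k
      ≤ gap f T i k * misestimates f T c ξ x i s j k
        + 8 * (if 0 < gap f T i k then Real.log T / gap f T i k else 0) + 2 * gap f T i k
        + gap f T i k * (2 * c.α / K * Real.sqrt (changeTime f T i - s : ℕ)) := by
  classical
  rcases (gap_nonneg (f := f) (T := T) i k).eq_or_lt with h0 | hpos
  · simp [← h0]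
  have hgap : gap f T i k = segMean f T i j - segMean f T i k := by rw [gap, hj]
  have hle := changeTime_le (f := f) (T := T) i
  have h := playCount_epoch_le c ξ x hs hα htie hse (T := T) (by omega) j k
    (by linarith : segMean f T i k < segMean f T i j)
  rw [← hgap] at h
  have hcard : ((((Finset.Ioc s (changeTime f T i)).filter fun t =>
      OverEstimates c ξ x s t k (segMean f T i k) ∨
        UnderEstimates c ξ x s t j (segMean f T i j)).card : ℕ) : ℝ)
      ≤ misestimates f T c ξ x i s j k := by
    rw [Finset.card_filter, misestimates]
    push_cast
    refine Finset.sum_le_sum fun t _ => ?_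
    split_ifs with h1 h2 h3 h3 <;> first | tauto | norm_num
  rw [if_pos hpos]
  have h' := mul_le_mul_of_nonneg_left (h.trans (add_le_add_left (add_le_add_left hcard _) _))
    hpos.le
  refine h'.trans (le_of_eq ?_)
  field_simp
  ring

/-- The loss in segment `i` when the last alarm before its end happens at `s`, in the segment or
later. -/
lemma sum_loss_segment_le (hα : 0 < c.α)
    (htie : ∀ S : Finset (Fin K), S.Nonempty → c.tie S ∈ S)
    (hm : ∀ t ∈ Finset.Icc 1 T, ∀ k, ∫ x, x ∂(f t k) ∈ Set.Icc (0 : ℝ) 1)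
    {i s : ℕ} (h1 : 1 ≤ i) (h2 : i ≤ numSegments f T) {j : Fin K}
    (hj : segMean f T i j = ⨆ j, segMean f T i j)
    (hνs : changeTime f T (i - 1) ≤ s) (hτ : alarmTime c ξ x T (i - 1) = s)
    (hτ' : ¬ alarmTime c ξ x T i < (changeTime f T i : ℕ∞)) :
    ∑ t ∈ Finset.Ioc (changeTime f T (i - 1)) (changeTime f T i), loss f t (armAt c ξ x t)
      ≤ ((s : ℝ) - changeTime f T (i - 1))
        + (8 * ∑ k, (if 0 < gap f T i k then Real.log T / gap f T i k else 0)
          + 2 * ∑ k, gap f T i k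
          + (if s < changeTime f T i then
              ∑ k, gap f T i k * misestimates f T c ξ x i s j k else 0))
        + 2 * c.α * Real.sqrt (changeTime f T i - changeTime f T (i - 1) : ℕ) := by
  have hT := changeTime_le (f := f) (T := T) i
  have hloss : ∀ t ∈ Finset.Ioc (changeTime f T (i - 1)) (changeTime f T i),
      loss f t (armAt c ξ x t) ≤ 1 := fun t ht => loss_le_one
    (hm t (by rw [Finset.mem_Ioc] at ht; rw [Finset.mem_Icc]; omega)) _
  have hlog : 0 ≤ ∑ k, (if 0 < gap f T i k then Real.log T / gap f T i k else 0) :=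
    Finset.sum_nonneg fun k _ => by
      have := Real.log_natCast_nonneg T
      split_ifs <;> positivity
  have hgaps : 0 ≤ ∑ k, gap f T i k := Finset.sum_nonneg fun k _ => gap_nonneg i k
  by_cases hse : s < changeTime f T i
  · rw [if_pos hse, ← Finset.sum_Ioc_consecutive _ hνs hse.le]
    have hfirst : ∑ t ∈ Finset.Ioc (changeTime f T (i - 1)) s, loss f t (armAt c ξ x t)
        ≤ (s : ℝ) - changeTime f T (i - 1) := by
      refine (Finset.sum_le_card_nsmul _ _ 1 fun t ht => hloss t ?_).trans (le_of_eq ?_)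
      · rw [Finset.mem_Ioc] at ht ⊢; omega
      · rw [Nat.card_Ioc, nsmul_eq_mul, mul_one, Nat.cast_sub hνs]
    -- The next alarm is not before the end of the segment, so one epoch covers the rest of it.
    have hrun : ∀ t, s ≤ t → t < changeTime f T i → (run c ξ x t).tau = s := by
      intro t hst hte
      refine run_tau_eq_of_lt_alarmTime c ξ x hτ hst (by omega) ?_
      rw [Nat.sub_add_cancel h1]
      exact lt_of_lt_of_le (by exact_mod_cast hte) (not_lt.1 hτ')
    have hsecond : ∑ t ∈ Finset.Ioc s (changeTime f T i), loss f t (armAt c ξ x t)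
        = ∑ k, gap f T i k * playCount c ξ x s (changeTime f T i) k := by
      rw [← sum_apply_armAt]
      refine Finset.sum_congr rfl fun t ht => loss_eq_gap h1 h2 ?_ _
      rw [Finset.mem_Ioc] at ht ⊢; omega
    have hbound := Finset.sum_le_sum fun k (_ : k ∈ Finset.univ) =>
      gap_mul_playCount_le c ξ x hα htie hj hse.le hrun k
    rw [← hsecond, Finset.sum_add_distrib, Finset.sum_add_distrib, Finset.sum_add_distrib,
      ← Finset.mul_sum, ← Finset.mul_sum, ← Finset.sum_mul] at hbound
    -- Gaps are at most 1, so summing over the arms cancels the `1 / K` in the exploration rate.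
    have hgK : ∑ k, gap f T i k ≤ K := by
      refine (Finset.sum_le_card_nsmul _ _ 1 fun k _ => ?_).trans (le_of_eq (by simp))
      have hmem : changeTime f T i ∈
          Finset.Ioc (changeTime f T (i - 1)) (changeTime f T i) := by
        rw [Finset.mem_Ioc]; omega
      rw [← loss_eq_gap h1 h2 hmem]
      exact loss_le_one (hm _ (by rw [Finset.mem_Icc]; omega)) k
    have hK : (0 : ℝ) < K := by exact_mod_cast Nat.pos_of_ne_zero (NeZero.ne K)
    have hexp : (∑ k, gap f T i k) * (2 * c.α / K * Real.sqrt (changeTime f T i - s : ℕ))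
        ≤ 2 * c.α * Real.sqrt (changeTime f T i - changeTime f T (i - 1) : ℕ) := by
      calc _ ≤ (K : ℝ) * (2 * c.α / K *
            Real.sqrt (changeTime f T i - changeTime f T (i - 1) : ℕ)) := by
            gcongr
        _ = _ := by field_simp
    linarith
  -- The alarm comes at or after the end of the segment: the delay alone exceeds the trivial bound
  -- by the length.
  · rw [if_neg hse]
    have : ∑ t ∈ Finset.Ioc (changeTime f T (i - 1)) (changeTime f T i),
        loss f t (armAt c ξ x t) ≤ (s : ℝ) - changeTime f T (i - 1) := by
      refine (Finset.sum_le_card_nsmul _ _ 1 hloss).trans ?_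
      rw [Nat.card_Ioc, nsmul_eq_mul, mul_one, Nat.cast_sub (changeTime_pred_le h1 h2)]
      have : (changeTime f T i : ℝ) ≤ s := by exact_mod_cast not_lt.1 hse
      linarith
    have hx : 0 ≤ 2 * c.α * Real.sqrt (changeTime f T i - changeTime f T (i - 1) : ℕ) := by
      positivity
    linarith

end EpochRegret

end Segments

section SegmentConst

variable {K : ℕ} {f : ℕ → Fin K → Measure ℝ} {T : ℕ}

variable (f T) in
/-- The deterministic part of the loss in segment `i`. -/
noncomputable def segmentConst (i : ℕ) : ℝ :=
  8 * ∑ k, (if 0 < gap f T i k then Real.log T / gap f T i k else 0) + 2 * ∑ k, gap f T i k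

lemma segmentConst_nonneg (i : ℕ) : 0 ≤ segmentConst f T i := by
  have := Real.log_natCast_nonneg T
  have h1 : 0 ≤ ∑ k, (if 0 < gap f T i k then Real.log T / gap f T i k else 0) :=
    Finset.sum_nonneg fun k _ => by split_ifs <;> positivity
  have h2 : 0 ≤ ∑ k, gap f T i k := Finset.sum_nonneg fun k _ => gap_nonneg i k
  unfold segmentConst
  linarith

end SegmentConst

/-! ### Pathwise decomposition into failures and delays -/

section Decomposition

variable {K : ℕ} [NeZero K] {Ω Ξ : Type*} {f : ℕ → Fin K → Measure ℝ} {X : ℕ → Fin K → Ω → ℝ}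
  {ξ : Ω → Ξ} {c : Config K Ξ} {T : ℕ} {h : ℕ → ℕ}

lemma falseAlarm_zero : falseAlarm f X ξ c T 0 = ∅ := by
  ext ω
  simp [falseAlarm, changeTime_zero]

lemma detected_zero : detected f X ξ c T h 0 = Set.univ := by
  ext ω
  simp [detected, alarm, alarmTime]

lemma le_alarm_of_notMem_falseAlarm {i : ℕ} {ω : Ω} (hω : ω ∉ falseAlarm f X ξ c T i) :
    (changeTime f T i : ℕ∞) ≤ alarm X ξ c T i ω := not_lt.1 hω

lemma exists_of_mem_detected {i : ℕ} {ω : Ω} (hω : ω ∈ detected f X ξ c T h i) :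
    ∃ s : ℕ, alarm X ξ c T i ω = s := by
  refine ENat.ne_top_iff_exists.1 ?_ |>.imp fun s hs => hs.symm
  unfold detected at hω
  split_ifs at hω with h1 h2
  · subst h1
    exact ne_of_eq_of_ne hω (by simp)
  · exact ne_top_of_le_ne_top (ENat.natCast_ne_top _) hω
  · exact ne_top_of_le_ne_top (ENat.natCast_ne_top _) hω

variable (f X ξ c T h) in
/-- All alarms up to the `i`-th are raised correctly, unless there is a first failure. -/
lemma failure_or_success (ω : Ω) (n : ℕ) :
    (∃ i ∈ Finset.Icc 1 n,
      ω ∈ falseAlarm f X ξ c T i ∩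
        ((falseAlarm f X ξ c T (i - 1))ᶜ ∩ detected f X ξ c T h (i - 1))) ∨
    (∃ i ∈ Finset.Icc 1 n,
      ω ∈ (detected f X ξ c T h i)ᶜ ∩ ((falseAlarm f X ξ c T i)ᶜ ∩
        (falseAlarm f X ξ c T (i - 1))ᶜ ∩ detected f X ξ c T h (i - 1))) ∨
    ∀ i ≤ n, ω ∉ falseAlarm f X ξ c T i ∧ ω ∈ detected f X ξ c T h i := by
  induction n with
  | zero =>
    refine Or.inr (Or.inr fun i hi => ?_)
    obtain rfl := Nat.le_zero.1 hi
    simp [falseAlarm_zero, detected_zero]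
  | succ n ih =>
    have hIcc : ∀ i ∈ Finset.Icc 1 n, i ∈ Finset.Icc 1 (n + 1) := fun i hi => by
      rw [Finset.mem_Icc] at *; omega
    have hn : n + 1 ∈ Finset.Icc 1 (n + 1) := by rw [Finset.mem_Icc]; omega
    rcases ih with ⟨i, hi, hω⟩ | ⟨i, hi, hω⟩ | hgood
    · exact Or.inl ⟨i, hIcc i hi, hω⟩
    · exact Or.inr (Or.inl ⟨i, hIcc i hi, hω⟩)
    · obtain ⟨h1, h2⟩ := hgood n le_rfl
      by_cases hF : ω ∈ falseAlarm f X ξ c T (n + 1)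
      · exact Or.inl ⟨n + 1, hn, hF, h1, h2⟩
      by_cases hD : ω ∈ detected f X ξ c T h (n + 1)
      · refine Or.inr (Or.inr fun i hi => ?_)
        rcases Nat.le_succ_iff.1 hi with hi | rfl
        · exact hgood i hi
        · exact ⟨hF, hD⟩
      · exact Or.inr (Or.inl ⟨n + 1, hn, hD, ⟨hF, h1⟩, h2⟩)

variable (f X ξ c T h) in
/-- The event `D_i F̄_i D_{i-1} F̄_{i-1}`. -/
def successPair (i : ℕ) : Set Ω :=
  detected f X ξ c T h i ∩ (falseAlarm f X ξ c T i)ᶜ ∩ detected f X ξ c T h (i - 1) ∩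
    (falseAlarm f X ξ c T (i - 1))ᶜ

lemma delay_nonneg {i : ℕ} {ω : Ω} (hω : ω ∈ successPair f X ξ c T h i) :
    0 ≤ ((alarm X ξ c T i ω).toNat : ℝ) - changeTime f T i := by
  obtain ⟨⟨⟨hD, hF⟩, -⟩, -⟩ := hω
  obtain ⟨s, hs⟩ := exists_of_mem_detected hD
  have : changeTime f T i ≤ s := by
    have := le_alarm_of_notMem_falseAlarm hF
    rw [hs] at this
    exact_mod_cast this
  rw [hs, ENat.toNat_natCast, sub_nonneg]
  exact_mod_cast this

variable (f X ξ c T) in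
open Classical in
/-- The misestimates of the epoch started by the `i - 1`-st alarm, if raised in segment `i`. -/
noncomputable def segmentMisestimates (i : ℕ) (j k : Fin K) (ω : Ω) : ℝ :=
  ∑ s ∈ Finset.Ico (changeTime f T (i - 1)) (changeTime f T i),
    if alarm X ξ c T (i - 1) ω = s then
      misestimates f T c (ξ ω) (fun r k => X r k ω) i s j k else 0

lemma segmentMisestimates_nonneg (i : ℕ) (j k : Fin K) (ω : Ω) :
    0 ≤ segmentMisestimates f X ξ c T i j k ω :=
  Finset.sum_nonneg fun s _ => by
    split_ifs
    · exact misestimates_nonneg c _ _ i s j k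
    · exact le_rfl

lemma misestimates_le_segmentMisestimates {i s : ℕ} (j k : Fin K) {ω : Ω}
    (hs : alarm X ξ c T (i - 1) ω = s) (h1 : changeTime f T (i - 1) ≤ s)
    (h2 : s < changeTime f T i) :
    misestimates f T c (ξ ω) (fun r k => X r k ω) i s j k
      ≤ segmentMisestimates f X ξ c T i j k ω := by
  classical
  have := Finset.single_le_sum (s := Finset.Ico (changeTime f T (i - 1)) (changeTime f T i))
    (f := fun s : ℕ => if alarm X ξ c T (i - 1) ω = s then
      misestimates f T c (ξ ω) (fun r k => X r k ω) i s j k else 0)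
    (fun s _ => by
      split_ifs
      · exact misestimates_nonneg c _ _ i s j k
      · exact le_rfl) (Finset.mem_Ico.2 ⟨h1, h2⟩)
  rw [if_pos hs] at this
  exact this

lemma sum_Icc_pred (g : ℕ → ℝ) (n : ℕ) :
    ∑ i ∈ Finset.Icc 1 (n + 1), g (i - 1) = g 0 + ∑ i ∈ Finset.Icc 1 n, g i := by
  induction n with
  | zero => simp
  | succ n ih =>
    rw [Finset.sum_Icc_succ_top (by omega), ih, Finset.sum_Icc_succ_top (by omega),
      Nat.add_sub_cancel, add_assoc]

lemma indicator_delay_nonneg (i : ℕ) (ω : Ω) :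
    0 ≤ (successPair f X ξ c T h i).indicator
      (fun ω => ((alarm X ξ c T i ω).toNat : ℝ) - changeTime f T i) ω :=
  Set.indicator_apply_nonneg delay_nonneg

/-- The pathwise decomposition of the loss. -/
lemma sum_loss_le (hα : 0 < c.α) (htie : ∀ S : Finset (Fin K), S.Nonempty → c.tie S ∈ S)
    (hm : ∀ t ∈ Finset.Icc 1 T, ∀ k, ∫ x, x ∂(f t k) ∈ Set.Icc (0 : ℝ) 1)
    {j : ℕ → Fin K} (hj : ∀ i, segMean f T i (j i) = ⨆ k, segMean f T i k) (ω : Ω) :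
    ∑ t ∈ Finset.Icc 1 T, loss f t (armAt c (ξ ω) (fun r k => X r k ω) t)
      ≤ (∑ i ∈ Finset.Icc 1 (numSegments f T), segmentConst f T i
          + 2 * c.α * Real.sqrt (numSegments f T * T))
        + ∑ i ∈ Finset.Icc 1 (numSegments f T),
            ∑ k, gap f T i k * segmentMisestimates f X ξ c T i (j i) k ω
        + ∑ i ∈ Finset.Icc 1 (numSegments f T - 1),
            (successPair f X ξ c T h i).indicator
              (fun ω => ((alarm X ξ c T i ω).toNat : ℝ) - changeTime f T i) ω
        + (∑ i ∈ Finset.Icc 1 (numSegments f T),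
            (falseAlarm f X ξ c T i ∩ ((falseAlarm f X ξ c T (i - 1))ᶜ ∩
              detected f X ξ c T h (i - 1))).indicator (fun _ => (T : ℝ)) ω
          + ∑ i ∈ Finset.Icc 1 (numSegments f T - 1),
            ((detected f X ξ c T h i)ᶜ ∩ ((falseAlarm f X ξ c T i)ᶜ ∩
              (falseAlarm f X ξ c T (i - 1))ᶜ ∩ detected f X ξ c T h (i - 1))).indicator
                (fun _ => (T : ℝ)) ω) := by
  set M := numSegments f T with hM
  have hM1 : 1 ≤ M := one_le_numSegments f T
  have n1 : 0 ≤ ∑ i ∈ Finset.Icc 1 M, segmentConst f T i :=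
    Finset.sum_nonneg fun i _ => segmentConst_nonneg i
  have n2 : 0 ≤ 2 * c.α * Real.sqrt (M * T) := by positivity
  have n3 : 0 ≤ ∑ i ∈ Finset.Icc 1 M,
      ∑ k, gap f T i k * segmentMisestimates f X ξ c T i (j i) k ω :=
    Finset.sum_nonneg fun i _ => Finset.sum_nonneg fun k _ =>
      mul_nonneg (gap_nonneg i k) (segmentMisestimates_nonneg i _ k ω)
  have n4 : 0 ≤ ∑ i ∈ Finset.Icc 1 (M - 1), (successPair f X ξ c T h i).indicator
      (fun ω => ((alarm X ξ c T i ω).toNat : ℝ) - changeTime f T i) ω :=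
    Finset.sum_nonneg fun i _ => indicator_delay_nonneg i ω
  have hind : ∀ E : Set Ω, 0 ≤ E.indicator (fun _ => (T : ℝ)) ω := fun E =>
    Set.indicator_apply_nonneg fun _ => Nat.cast_nonneg T
  have n5 : ∀ (n : ℕ) (E : ℕ → Set Ω),
      0 ≤ ∑ i ∈ Finset.Icc 1 n, (E i).indicator (fun _ => (T : ℝ)) ω :=
    fun n E => Finset.sum_nonneg fun i _ => hind _
  have hfail : ∀ (n : ℕ) (E : ℕ → Set Ω), (∃ i ∈ Finset.Icc 1 n, ω ∈ E i) →
      (T : ℝ) ≤ ∑ i ∈ Finset.Icc 1 n, (E i).indicator (fun _ => (T : ℝ)) ω := by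
    rintro n E ⟨i, hi, hω⟩
    have := Finset.single_le_sum (f := fun i => (E i).indicator (fun _ => (T : ℝ)) ω)
      (fun i _ => hind (E i)) hi
    rwa [Set.indicator_of_mem hω] at this
  have htotal : ∑ t ∈ Finset.Icc 1 T, loss f t (armAt c (ξ ω) (fun r k => X r k ω) t) ≤ T := by
    refine (Finset.sum_le_card_nsmul _ _ 1 fun t ht => loss_le_one (hm t ht) _).trans ?_
    simp
  have m1 := n5 M fun i => falseAlarm f X ξ c T i ∩ ((falseAlarm f X ξ c T (i - 1))ᶜ ∩
    detected f X ξ c T h (i - 1))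
  have m2 := n5 (M - 1) fun i => (detected f X ξ c T h i)ᶜ ∩ ((falseAlarm f X ξ c T i)ᶜ ∩
    (falseAlarm f X ξ c T (i - 1))ᶜ ∩ detected f X ξ c T h (i - 1))
  by_cases hF : ∃ i ∈ Finset.Icc 1 M, ω ∈ falseAlarm f X ξ c T i ∩
      ((falseAlarm f X ξ c T (i - 1))ᶜ ∩ detected f X ξ c T h (i - 1))
  · have := hfail M _ hF
    linarith
  -- Detection is only needed up to `M - 1`; a false `M`-th alarm, before the horizon ends, is
  -- covered by `hF`.
  rcases failure_or_success f X ξ c T h ω (M - 1) with ⟨i, hi, hω⟩ | hD | hgood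
  · refine absurd ⟨i, ?_, hω⟩ hF
    rw [Finset.mem_Icc] at *; omega
  · have := hfail (M - 1) _ hD
    linarith
  have hgood' : ∀ i ∈ Finset.Icc 1 M, ω ∉ falseAlarm f X ξ c T i := by
    intro i hi hω
    obtain ⟨h1, h2⟩ := hgood (i - 1) (by rw [Finset.mem_Icc] at hi; omega)
    exact hF ⟨i, hi, hω, h1, h2⟩
  have hseg : ∀ i ∈ Finset.Icc 1 M,
      ∑ t ∈ Finset.Ioc (changeTime f T (i - 1)) (changeTime f T i),
        loss f t (armAt c (ξ ω) (fun r k => X r k ω) t)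
      ≤ (((alarm X ξ c T (i - 1) ω).toNat : ℝ) - changeTime f T (i - 1))
        + (segmentConst f T i
          + ∑ k, gap f T i k * segmentMisestimates f X ξ c T i (j i) k ω)
        + 2 * c.α * Real.sqrt (changeTime f T i - changeTime f T (i - 1) : ℕ) := by
    intro i hi
    have hi' := Finset.mem_Icc.1 hi
    obtain ⟨h1, h2⟩ := hgood (i - 1) (by omega)
    obtain ⟨s, hs⟩ := exists_of_mem_detected h2
    have hνs : changeTime f T (i - 1) ≤ s := by
      have := le_alarm_of_notMem_falseAlarm h1
      rw [hs] at this
      exact_mod_cast this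
    refine (sum_loss_segment_le c (ξ ω) (fun r k => X r k ω) hα htie hm hi'.1 hi'.2 (hj i)
      hνs hs (hgood' i hi)).trans ?_
    rw [hs, ENat.toNat_natCast, segmentConst]
    gcongr
    split_ifs with hse
    · exact Finset.sum_le_sum fun k _ => mul_le_mul_of_nonneg_left
        (misestimates_le_segmentMisestimates (j i) k hs hνs hse) (gap_nonneg i k)
    · exact Finset.sum_nonneg fun k _ =>
        mul_nonneg (gap_nonneg i k) (segmentMisestimates_nonneg i _ k ω)
  -- Segment `i` pays the delay of alarm `i - 1`. The first delay is 0, so a shift of index leaves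
  -- the delays of alarms `1, …, M - 1`.
  have hdelay : ∑ i ∈ Finset.Icc 1 M,
      (((alarm X ξ c T (i - 1) ω).toNat : ℝ) - changeTime f T (i - 1))
      = ∑ i ∈ Finset.Icc 1 (M - 1), (successPair f X ξ c T h i).indicator
        (fun ω => ((alarm X ξ c T i ω).toNat : ℝ) - changeTime f T i) ω := by
    have := sum_Icc_pred
      (fun i => ((alarm X ξ c T i ω).toNat : ℝ) - changeTime f T i) (M - 1)
    rw [Nat.sub_add_cancel hM1] at this
    rw [this]
    have h0 : alarm X ξ c T 0 ω = 0 := rfl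
    simp only [h0, changeTime_zero, ENat.toNat_zero, sub_self, zero_add]
    refine Finset.sum_congr rfl fun i hi => ?_
    have hi' := Finset.mem_Icc.1 hi
    rw [Set.indicator_of_mem]
    obtain ⟨h1, h2⟩ := hgood i hi'.2
    obtain ⟨h3, h4⟩ := hgood (i - 1) (by omega)
    exact ⟨⟨⟨h2, h1⟩, h4⟩, h3⟩
  have hsum := Finset.sum_le_sum hseg
  rw [sum_segments, Finset.sum_add_distrib, Finset.sum_add_distrib, Finset.sum_add_distrib,
    hdelay, ← Finset.mul_sum] at hsum
  have hsqrt := mul_le_mul_of_nonneg_left (sum_sqrt_segment_lengths_le (f := f) (T := T))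
    (by positivity : 0 ≤ 2 * c.α)
  linarith

end Decomposition

/-! ### Irrelevance of rewards outside the horizon -/

section Reduction

variable {K : ℕ} [NeZero K] {Ω Ξ : Type*} {X Y : ℕ → Fin K → Ω → ℝ} {T : ℕ}
  (hXY : ∀ t ∈ Finset.Icc 1 T, X t = Y t) (ξ : Ω → Ξ) (c : Config K Ξ)
include hXY

lemma alarm_congr : alarm X ξ c T = alarm Y ξ c T := by
  funext i ω
  exact alarmTime_congr c (ξ ω) (fun r h1 h2 => by
    funext k
    rw [hXY r (Finset.mem_Icc.2 ⟨h1, h2⟩)]) i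

lemma regret_congr [MeasurableSpace Ω] (P : Measure Ω) :
    regret P X ξ c T = regret P Y ξ c T := by
  unfold regret
  congr 1
  · exact Finset.sum_congr rfl fun t ht => by rw [hXY t ht]
  · congr 1
    funext ω
    refine Finset.sum_congr rfl fun t ht => ?_
    have : armAt c (ξ ω) (fun s k => X s k ω) t = armAt c (ξ ω) (fun s k => Y s k ω) t :=
      armAt_congr c (ξ ω) fun r h1 h2 => by
        funext k
        rw [hXY r (Finset.mem_Icc.2 ⟨h1, by have := (Finset.mem_Icc.1 ht).2; omega⟩)]
    rw [this, hXY t ht]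

end Reduction

/-! ### Integration of the pathwise bound -/

section Expectation

lemma sum_inv_sq_le (s e : ℕ) :
    ∑ t ∈ Finset.Ioc s e, 1 / ((t - s : ℕ) : ℝ) ^ 2 ≤ Real.pi ^ 2 / 6 := by
  have hinj : Set.InjOn (fun t => t - s) (Finset.Ioc s e : Set ℕ) := by
    intro a ha b hb hab
    simp only [Finset.coe_Ioc, Set.mem_Ioc] at ha hb hab
    omega
  rw [← Finset.sum_image (f := fun q : ℕ => 1 / (q : ℝ) ^ 2) hinj]
  exact sum_le_hasSum _ (fun _ _ => by positivity) hasSum_zeta_two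

variable {K : ℕ} [NeZero K] {Ω Ξ : Type*} [MeasurableSpace Ω] [MeasurableSpace Ξ]
  {P : Measure Ω} [IsProbabilityMeasure P] {f : ℕ → Fin K → Measure ℝ}
  {X : ℕ → Fin K → Ω → ℝ} {ξ : Ω → Ξ} {c : Config K Ξ} {T : ℕ}

/-- A conditional probability dominates the probability of the intersection. -/
lemma measureReal_inter_le_cond {A B : Set Ω} (hB : MeasurableSet B) :
    P.real (A ∩ B) ≤ (P[|B]).real A := by
  have hcond : (P[|B]).real A = (P.real B)⁻¹ * P.real (B ∩ A) := by
    simp only [measureReal_def, cond_apply hB, ENNReal.toReal_mul, ENNReal.toReal_inv]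
  rw [hcond, Set.inter_comm]
  rcases (measureReal_nonneg (μ := P) (s := B)).eq_or_lt with h0 | hpos
  · have : P.real (B ∩ A) ≤ P.real B :=
      measureReal_mono Set.inter_subset_left (measure_ne_top P _)
    rw [← h0] at this ⊢
    simpa using this
  · exact le_mul_of_one_le_left measureReal_nonneg
      ((one_le_inv₀ hpos).2 measureReal_le_one)

/-- Conditioning divides a nonnegative integral over `B` by `P B ≤ 1`; on a null `B` both sides are
0. -/
lemma integral_indicator_le_cond {B : Set Ω} (hB : MeasurableSet B) {g : Ω → ℝ}
    (hg : ∀ ω ∈ B, 0 ≤ g ω) : ∫ ω, B.indicator g ω ∂P ≤ ∫ ω, g ω ∂(P[|B]) := by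
  rw [integral_indicator hB, ProbabilityTheory.cond, integral_smul_measure, smul_eq_mul]
  have hnn : 0 ≤ ∫ ω in B, g ω ∂P := setIntegral_nonneg hB hg
  by_cases h0 : P B = 0
  · rw [setIntegral_measure_zero _ h0]
    simp
  · refine le_mul_of_one_le_left hnn ?_
    rw [ENNReal.toReal_inv]
    have hpos : 0 < (P B).toReal := ENNReal.toReal_pos h0 (measure_ne_top P B)
    exact (one_le_inv₀ hpos).2 (ENNReal.toReal_mono ENNReal.one_ne_top prob_le_one)

variable (env : IsEnvironment P f X ξ T)
  (hcd : ∀ t τ : ℕ, MeasurableSet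
      {p : Ξ × (ℕ → Fin K) × (ℕ → ℝ) | c.cd p.1 t τ p.2.1 p.2.2})
include env

omit [NeZero K] in
lemma IsEnvironment.mean_mem_Icc {t : ℕ} (ht : t ∈ Finset.Icc 1 T) (k : Fin K) :
    ∫ x, x ∂(f t k) ∈ Set.Icc (0 : ℝ) 1 := by
  rw [env.integral_law ht k]
  have h := env.reward_mem_Icc ht k
  refine ⟨integral_nonneg_of_ae (h.mono fun ω hω => hω.1), ?_⟩
  have := integral_mono_of_nonneg (μ := P) (f := X t k) (g := fun _ => (1 : ℝ))
    (h.mono fun ω hω => hω.1) (integrable_const _) (h.mono fun ω hω => hω.2)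
  simpa using this

omit [NeZero K] in
lemma IsEnvironment.integrable_reward {t : ℕ} (ht : t ∈ Finset.Icc 1 T) (k : Fin K) :
    Integrable (X t k) P :=
  Integrable.of_mem_Icc 0 1 (env.measurable t k).aemeasurable (env.reward_mem_Icc ht k)

include hcd

omit [IsProbabilityMeasure P] in
lemma measurable_armAt_outcome (t : ℕ) :
    Measurable fun ω => armAt c (ξ ω) (fun r k => X r k ω) t :=
  (measurable_armAt hcd t).comp env.measurable_outcome

omit [IsProbabilityMeasure P] in
lemma measurableSet_alarm_eq (i s : ℕ) : MeasurableSet {ω | alarm X ξ c T i ω = s} :=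
  env.measurable_outcome (measurableSet_alarmTime_eq hcd T i s)

omit [IsProbabilityMeasure P] in
lemma measurableSet_alarm_lt (i n : ℕ) : MeasurableSet {ω | alarm X ξ c T i ω < (n : ℕ∞)} := by
  have : {ω | alarm X ξ c T i ω < (n : ℕ∞)}
      = ⋃ s ∈ Finset.range n, {ω | alarm X ξ c T i ω = s} := by
    ext ω
    simp only [Set.mem_ofPred_eq, Set.mem_iUnion, Finset.mem_range, exists_prop]
    constructor
    · intro h
      obtain ⟨s, hs⟩ := ENat.ne_top_iff_exists.1 h.ne_top
      rw [← hs] at h ⊢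
      exact ⟨s, by exact_mod_cast h, rfl⟩
    · rintro ⟨s, hs, h⟩
      rw [h]
      exact_mod_cast hs
  rw [this]
  exact Finset.measurableSet_biUnion _ fun s _ => measurableSet_alarm_eq env hcd i s

omit [IsProbabilityMeasure P] in
lemma measurableSet_alarm_le (i n : ℕ) : MeasurableSet {ω | alarm X ξ c T i ω ≤ (n : ℕ∞)} := by
  have : {ω | alarm X ξ c T i ω ≤ (n : ℕ∞)} = {ω | alarm X ξ c T i ω < ((n + 1 : ℕ) : ℕ∞)} := by
    ext ω
    simp only [Set.mem_ofPred_eq, Nat.cast_add, Nat.cast_one]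
    exact (ENat.lt_add_one_iff (ENat.natCast_ne_top n)).symm
  rw [this]
  exact measurableSet_alarm_lt env hcd i (n + 1)

omit [IsProbabilityMeasure P] in
lemma measurableSet_falseAlarm (i : ℕ) : MeasurableSet (falseAlarm f X ξ c T i) :=
  measurableSet_alarm_lt env hcd i _

omit [IsProbabilityMeasure P] in
lemma measurableSet_detected (h : ℕ → ℕ) (i : ℕ) :
    MeasurableSet (detected f X ξ c T h i) := by
  unfold detected
  split_ifs
  · exact measurableSet_alarm_eq env hcd 0 0
  · exact measurableSet_alarm_le env hcd i T
  · exact measurableSet_alarm_le env hcd i _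

omit [IsProbabilityMeasure P] in
lemma measurable_toNat_alarm (i : ℕ) :
    Measurable fun ω => ((alarm X ξ c T i ω).toNat : ℝ) := by
  classical
  have : (fun ω => ((alarm X ξ c T i ω).toNat : ℝ))
      = fun ω => ∑ s ∈ Finset.range (T + 1), if alarm X ξ c T i ω = s then (s : ℝ) else 0 := by
    funext ω
    by_cases htop : alarm X ξ c T i ω = ⊤
    · simp [htop]
    · obtain ⟨s, hs, hsT, -⟩ := exists_of_alarmTime_ne_top c (ξ ω) (fun r k => X r k ω) htop
      change alarm X ξ c T i ω = s at hs
      simp only [hs, ENat.toNat_natCast, Nat.cast_inj, Finset.sum_ite_eq, Finset.mem_range]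
      rw [if_pos (by omega)]
  rw [this]
  exact Finset.measurable_sum _ fun s _ =>
    Measurable.ite (measurableSet_alarm_eq env hcd i s) measurable_const measurable_const

/-- A missing alarm has `toNat` equal to 0, so the values always lie in `[0, T]`. -/
lemma integrable_toNat_alarm (i : ℕ) :
    Integrable (fun ω => ((alarm X ξ c T i ω).toNat : ℝ)) P := by
  refine Integrable.of_mem_Icc 0 T (measurable_toNat_alarm env hcd i).aemeasurable
    (Filter.Eventually.of_forall fun ω => ⟨Nat.cast_nonneg _, ?_⟩)
  by_cases htop : alarm X ξ c T i ω = ⊤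
  · simp [htop]
  · obtain ⟨s, hs, hsT, -⟩ := exists_of_alarmTime_ne_top c (ξ ω) (fun r k => X r k ω) htop
    change alarm X ξ c T i ω = s at hs
    rw [hs, ENat.toNat_natCast]
    exact_mod_cast hsT

lemma integrable_apply_armAt (g : Fin K → ℝ) (t : ℕ) :
    Integrable (fun ω => g (armAt c (ξ ω) (fun r k => X r k ω) t)) P :=
  Integrable.of_finite.comp_measurable (g := g) (measurable_armAt_outcome env hcd t)

/-- The indicator of each possible arm depends on the past only, hence is independent of the reward
of that arm in round `t`. -/
lemma integral_reward_armAt {t : ℕ} (ht : t ∈ Finset.Icc 1 T) :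
    Integrable (fun ω => X t (armAt c (ξ ω) (fun r k => X r k ω) t) ω) P ∧
    ∫ ω, X t (armAt c (ξ ω) (fun r k => X r k ω) t) ω ∂P
      = ∫ ω, (fun k => ∫ x, x ∂(f t k)) (armAt c (ξ ω) (fun r k => X r k ω) t) ∂P := by
  classical
  obtain ⟨q, rfl⟩ : ∃ q, t = q + 1 := ⟨t - 1, by rw [Finset.mem_Icc] at ht; omega⟩
  set a : Fin K → Ω → ℝ := fun k ω =>
    if armAt c (ξ ω) (fun r k => X r k ω) (q + 1) = k then 1 else 0 with ha
  have ham : ∀ k, Measurable (a k) := fun k => Measurable.ite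
    ((measurable_armAt_outcome env hcd (q + 1)) (measurableSet_singleton k))
    measurable_const measurable_const
  have hai : ∀ k, Integrable (a k) P := fun k =>
    integrable_apply_armAt env hcd (fun k' => if k' = k then 1 else 0) (q + 1)
  have hind : ∀ k, IndepFun (a k) (X (q + 1) k) P := by
    intro k
    have hg : Measurable fun p : Ξ × (ℕ → Fin K → ℝ) =>
        if armAt c p.1 p.2 (q + 1) = k then (1 : ℝ) else 0 :=
      Measurable.ite ((measurable_armAt hcd (q + 1)) (measurableSet_singleton k))
        measurable_const measurable_const
    exact (env.indepFun_of_nonAnticipating ht hg fun ξ' x y hxy => by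
      rw [armAt_congr c ξ' fun r h1 h2 => hxy r h1 (by omega)]).comp measurable_id
      (measurable_pi_apply k)
  have hint : ∀ k, Integrable (fun ω => a k ω * X (q + 1) k ω) P := fun k =>
    (hind k).integrable_mul (hai k) (env.integrable_reward ht k)
  have hX : (fun ω => X (q + 1) (armAt c (ξ ω) (fun r k => X r k ω) (q + 1)) ω)
      = fun ω => ∑ k, a k ω * X (q + 1) k ω := by
    funext ω; simp [ha]
  have hμ : (fun ω => (fun k => ∫ x, x ∂(f (q + 1) k))
      (armAt c (ξ ω) (fun r k => X r k ω) (q + 1)))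
      = fun ω => ∑ k, a k ω * ∫ x, x ∂(f (q + 1) k) := by
    funext ω; simp [ha]
  rw [hX, hμ]
  refine ⟨integrable_finsetSum _ fun k _ => hint k, ?_⟩
  rw [integral_finsetSum _ fun k _ => hint k,
    integral_finsetSum _ fun k _ => (hai k).mul_const _]
  refine Finset.sum_congr rfl fun k _ => ?_
  rw [(hind k).integral_fun_mul_eq_mul_integral (ham k).aestronglyMeasurable
    (env.measurable _ k).aestronglyMeasurable, integral_mul_const, env.integral_law ht k]

/-- The regret is the expected sum of the losses of the arms played. -/
lemma regret_eq :
    regret P X ξ c T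
      = ∫ ω, ∑ t ∈ Finset.Icc 1 T, loss f t (armAt c (ξ ω) (fun r k => X r k ω) t) ∂P := by
  rw [regret, integral_finsetSum _ fun t ht => (integral_reward_armAt env hcd ht).1,
    integral_finsetSum _ fun t ht => integrable_apply_armAt env hcd (loss f t) t,
    ← Finset.sum_sub_distrib]
  refine Finset.sum_congr rfl fun t ht => ?_
  rw [(integral_reward_armAt env hcd ht).2]
  simp only [loss]
  rw [integral_sub (integrable_const _)
    (integrable_apply_armAt env hcd (fun k => ∫ x, x ∂(f t k)) t)]
  simp [env.integral_law ht]

lemma sum_measure_alarm_eq_le_one (i : ℕ) (S : Finset ℕ) :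
    ∑ s ∈ S, P.real {ω | alarm X ξ c T i ω = s} ≤ 1 := by
  rw [← measureReal_biUnion_finset]
  · exact measureReal_le_one
  · intro s _ s' _ hss'
    refine Set.disjoint_left.2 fun ω h1 h2 => hss' ?_
    have : (s : ℕ∞) = s' := Eq.trans (Eq.symm h1) h2
    exact_mod_cast this
  · exact fun s _ => measurableSet_alarm_eq env hcd i s

omit [IsProbabilityMeasure P] in
lemma measurableSet_alarm_overEstimates (i s s' t : ℕ) (k : Fin K) (m : ℝ) :
    MeasurableSet {ω | alarm X ξ c T i ω = s ∧
      OverEstimates c (ξ ω) (fun r k => X r k ω) s' t k m} :=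
  (measurableSet_alarm_eq env hcd i s).inter
    (env.measurable_outcome (measurableSet_overEstimates hcd s' t k m))

omit [IsProbabilityMeasure P] in
lemma measurableSet_alarm_underEstimates (i s s' t : ℕ) (k : Fin K) (m : ℝ) :
    MeasurableSet {ω | alarm X ξ c T i ω = s ∧
      UnderEstimates c (ξ ω) (fun r k => X r k ω) s' t k m} :=
  (measurableSet_alarm_eq env hcd i s).inter
    (env.measurable_outcome (measurableSet_underEstimates hcd s' t k m))

omit env hcd [MeasurableSpace Ω] [MeasurableSpace Ξ] in
lemma segmentMisestimates_eq (i : ℕ) (j k : Fin K) :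
    segmentMisestimates f X ξ c T i j k = fun ω =>
      ∑ s ∈ Finset.Ico (changeTime f T (i - 1)) (changeTime f T i),
        ∑ t ∈ Finset.Ioc s (changeTime f T i),
          ({ω | alarm X ξ c T (i - 1) ω = s ∧ OverEstimates c (ξ ω) (fun r k => X r k ω) s t k
              (segMean f T i k)}.indicator 1 ω
            + {ω | alarm X ξ c T (i - 1) ω = s ∧ UnderEstimates c (ξ ω) (fun r k => X r k ω) s t
              j (segMean f T i j)}.indicator 1 ω : ℝ) := by
  classical
  funext ω
  refine Finset.sum_congr rfl fun s _ => ?_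
  by_cases hs : alarm X ξ c T (i - 1) ω = s
  · rw [if_pos hs, misestimates]
    refine Finset.sum_congr rfl fun t _ => ?_
    simp [Set.indicator_apply, hs]
  · rw [if_neg hs]
    simp [hs]

lemma integrable_segmentMisestimates (i : ℕ) (j k : Fin K) :
    Integrable (segmentMisestimates f X ξ c T i j k) P := by
  rw [segmentMisestimates_eq]
  exact integrable_finsetSum _ fun s _ => integrable_finsetSum _ fun t _ =>
    ((integrable_const 1).indicator (measurableSet_alarm_overEstimates env hcd _ s s t k _)).add
      ((integrable_const 1).indicator (measurableSet_alarm_underEstimates env hcd _ s s t j _))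

/-- For a fixed start `s`, two tails and `∑ 1/d² ≤ π²/6` give `P(τ_{i-1} = s) · π²/3`; the events
for different `s` are disjoint, so their probabilities add up to at most 1. -/
lemma integral_segmentMisestimates_le {i : ℕ} (h1 : 1 ≤ i) (h2 : i ≤ numSegments f T)
    (j k : Fin K) :
    ∫ ω, segmentMisestimates f X ξ c T i j k ω ∂P ≤ Real.pi ^ 2 / 3 := by
  have hO := fun s t => measurableSet_alarm_overEstimates env hcd (i - 1) s s t k
    (segMean f T i k)
  have hU := fun s t => measurableSet_alarm_underEstimates env hcd (i - 1) s s t j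
    (segMean f T i j)
  have hOi : ∀ s t : ℕ, Integrable ({ω | alarm X ξ c T (i - 1) ω = s ∧ OverEstimates c (ξ ω)
      (fun r k => X r k ω) s t k (segMean f T i k)}.indicator (1 : Ω → ℝ)) P :=
    fun s t => (integrable_const (1 : ℝ)).indicator (hO s t)
  have hUi : ∀ s t : ℕ, Integrable ({ω | alarm X ξ c T (i - 1) ω = s ∧ UnderEstimates c (ξ ω)
      (fun r k => X r k ω) s t j (segMean f T i j)}.indicator (1 : Ω → ℝ)) P :=
    fun s t => (integrable_const (1 : ℝ)).indicator (hU s t)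
  have hOU : ∀ s t : ℕ, Integrable (fun ω => ({ω | alarm X ξ c T (i - 1) ω = s ∧
          OverEstimates c (ξ ω) (fun r k => X r k ω) s t k (segMean f T i k)}.indicator 1 ω
        + {ω | alarm X ξ c T (i - 1) ω = s ∧
          UnderEstimates c (ξ ω) (fun r k => X r k ω) s t j (segMean f T i j)}.indicator 1 ω : ℝ)) P :=
    fun s t => (hOi s t).add (hUi s t)
  rw [segmentMisestimates_eq]
  rw [integral_finsetSum _ fun s _ => integrable_finsetSum _ fun t _ => hOU s t]
  have hterm : ∀ s ∈ Finset.Ico (changeTime f T (i - 1)) (changeTime f T i),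
      ∫ ω, ∑ t ∈ Finset.Ioc s (changeTime f T i),
          ({ω | alarm X ξ c T (i - 1) ω = s ∧ OverEstimates c (ξ ω) (fun r k => X r k ω) s t k
              (segMean f T i k)}.indicator 1 ω
            + {ω | alarm X ξ c T (i - 1) ω = s ∧ UnderEstimates c (ξ ω) (fun r k => X r k ω) s t
              j (segMean f T i j)}.indicator 1 ω : ℝ) ∂P
      ≤ P.real {ω | alarm X ξ c T (i - 1) ω = s} * (Real.pi ^ 2 / 3) := by
    intro s hs
    have hs' := Finset.mem_Ico.1 hs
    have hT := changeTime_le (f := f) (T := T) i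
    rw [integral_finsetSum _ fun t _ => hOU s t]
    have hle : ∀ t ∈ Finset.Ioc s (changeTime f T i),
        ∫ ω, ({ω | alarm X ξ c T (i - 1) ω = s ∧
            OverEstimates c (ξ ω) (fun r k => X r k ω) s t k
              (segMean f T i k)}.indicator 1 ω
            + {ω | alarm X ξ c T (i - 1) ω = s ∧ UnderEstimates c (ξ ω) (fun r k => X r k ω) s t
              j (segMean f T i j)}.indicator 1 ω : ℝ) ∂P
        ≤ 2 * P.real {ω | alarm X ξ c T (i - 1) ω = s} * (1 / ((t - s : ℕ) : ℝ) ^ 2) := by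
      intro t ht
      have ht' := Finset.mem_Ioc.1 ht
      rw [integral_add (hOi s t) (hUi s t), integral_indicator_one (hO s t),
        integral_indicator_one (hU s t)]
      have hB := measurableSet_alarmTime_eq hcd T (i - 1) s
      have hBs : NonAnticipating s fun p : Ξ × (ℕ → Fin K → ℝ) =>
          p ∈ {p : Ξ × (ℕ → Fin K → ℝ) | alarmTime c p.1 p.2 T (i - 1) = s} :=
        fun ξ' x y hxy => propext (alarmTime_eq_coe_congr c ξ' x hxy T (i - 1))
      have hmean : ∀ k', ∀ r ∈ Finset.Ioc s t, ∫ x, x ∂(f r k') = segMean f T i k' :=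
        fun k' r hr => (segMean_eq h1 h2 (by rw [Finset.mem_Ioc] at hr ⊢; omega) k').symm
      have e1 := measure_overEstimates_le env hcd hB hBs k ht'.1 (by omega) (hmean k)
      have e2 := measure_underEstimates_le env hcd hB hBs j ht'.1 (by omega) (hmean j)
      refine (add_le_add e1 e2).trans (le_of_eq ?_)
      rw [← two_mul, mul_assoc]
      rfl
    refine (Finset.sum_le_sum hle).trans ?_
    rw [← Finset.mul_sum]
    have hz := mul_le_mul_of_nonneg_left (sum_inv_sq_le s (changeTime f T i))
      (by positivity : 0 ≤ 2 * P.real {ω | alarm X ξ c T (i - 1) ω = s})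
    refine hz.trans (le_of_eq ?_)
    ring
  refine (Finset.sum_le_sum hterm).trans ?_
  rw [← Finset.sum_mul]
  exact mul_le_of_le_one_left (by positivity) (sum_measure_alarm_eq_le_one env hcd _ _)

omit env hcd [MeasurableSpace Ω] [MeasurableSpace Ξ] [NeZero K] in
-- The argument yields the constant `2 + π²/3`, which `5/2 + π²/3 + K` dominates.
lemma segmentConst_add_le_ucbConst (i : ℕ) :
    segmentConst f T i + ∑ k, gap f T i k * (Real.pi ^ 2 / 3) ≤ ucbConst f T i := by
  classical
  have hg : 0 ≤ ∑ k, gap f T i k := Finset.sum_nonneg fun k _ => gap_nonneg i k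
  rw [segmentConst, ucbConst, ← Finset.sum_mul, Finset.sum_filter]
  have hK : (0 : ℝ) ≤ K := Nat.cast_nonneg K
  nlinarith

/-- The regret bound, for rewards that are measurable at all times. -/
lemma regret_le (hα : 0 < c.α) (htie : ∀ S : Finset (Fin K), S.Nonempty → c.tie S ∈ S)
    (h : ℕ → ℕ) :
    regret P X ξ c T ≤
      ∑ i ∈ Finset.Icc 1 (numSegments f T), ucbConst f T i
      + 2 * c.α * Real.sqrt (numSegments f T * T)
      + ∑ i ∈ Finset.Icc 1 (numSegments f T - 1),
          ∫ ω, (((alarm X ξ c T i ω).toNat : ℝ) - (changeTime f T i : ℝ))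
            ∂(P[|successPair f X ξ c T h i])
      + (T * ∑ i ∈ Finset.Icc 1 (numSegments f T),
            (P[|(falseAlarm f X ξ c T (i - 1))ᶜ ∩ detected f X ξ c T h (i - 1)]).real
              (falseAlarm f X ξ c T i)
        + T * ∑ i ∈ Finset.Icc 1 (numSegments f T - 1),
            (P[|(falseAlarm f X ξ c T i)ᶜ ∩ (falseAlarm f X ξ c T (i - 1))ᶜ ∩
              detected f X ξ c T h (i - 1)]).real (detected f X ξ c T h i)ᶜ) := by
  choose j hj using exists_segMean_eq_iSup (f := f) (T := T)
  have hF := measurableSet_falseAlarm env hcd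
  have hD := measurableSet_detected env hcd h
  have hS : ∀ i, MeasurableSet (successPair f X ξ c T h i) := fun i =>
    (((hD i).inter (hF i).compl).inter (hD (i - 1))).inter (hF (i - 1)).compl
  have hB1 : ∀ i, MeasurableSet ((falseAlarm f X ξ c T (i - 1))ᶜ ∩
      detected f X ξ c T h (i - 1)) := fun i => (hF _).compl.inter (hD _)
  have hB2 : ∀ i, MeasurableSet ((falseAlarm f X ξ c T i)ᶜ ∩
      (falseAlarm f X ξ c T (i - 1))ᶜ ∩ detected f X ξ c T h (i - 1)) := fun i =>
    ((hF _).compl.inter (hF _).compl).inter (hD _)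
  have i1 : Integrable (fun ω => ∑ i ∈ Finset.Icc 1 (numSegments f T),
      ∑ k, gap f T i k * segmentMisestimates f X ξ c T i (j i) k ω) P :=
    integrable_finsetSum _ fun i _ => integrable_finsetSum _ fun k _ =>
      (integrable_segmentMisestimates env hcd i (j i) k).const_mul _
  have i2' : ∀ i, Integrable ((successPair f X ξ c T h i).indicator
      fun ω => ((alarm X ξ c T i ω).toNat : ℝ) - changeTime f T i) P := fun i =>
    ((integrable_toNat_alarm env hcd i).sub (integrable_const _)).indicator (hS i)
  have i2 := integrable_finsetSum (Finset.Icc 1 (numSegments f T - 1)) fun i _ => i2' i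
  have i3' : ∀ E : Set Ω, MeasurableSet E → Integrable (E.indicator fun _ => (T : ℝ)) P :=
    fun E hE => (integrable_const _).indicator hE
  have i3 := integrable_finsetSum (Finset.Icc 1 (numSegments f T)) fun i _ =>
    i3' _ ((hF i).inter (hB1 i))
  have i4 := integrable_finsetSum (Finset.Icc 1 (numSegments f T - 1)) fun i _ =>
    i3' _ ((hD i).compl.inter (hB2 i))
  have i12 := ((integrable_const (μ := P) (∑ i ∈ Finset.Icc 1 (numSegments f T),
    segmentConst f T i + 2 * c.α * Real.sqrt (numSegments f T * T))).add i1).add i2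
  rw [regret_eq env hcd]
  refine (integral_mono (integrable_finsetSum _ fun t _ =>
    integrable_apply_armAt env hcd (loss f t) t) (i12.add (i3.add i4)) fun ω => ?_).trans ?_
  · exact sum_loss_le hα htie (fun t ht k => env.mean_mem_Icc ht k) hj ω
  have hpen : ∀ A B : Set Ω, MeasurableSet A → MeasurableSet B →
      ∫ ω, (A ∩ B).indicator (fun _ => (T : ℝ)) ω ∂P ≤ T * (P[|B]).real A := by
    intro A B hA hB
    rw [integral_indicator (hA.inter hB), setIntegral_const, smul_eq_mul, mul_comm]
    exact mul_le_mul_of_nonneg_left (measureReal_inter_le_cond hB) (Nat.cast_nonneg T)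
  rw [integral_add' i12 (i3.add i4), integral_add' ((integrable_const _).add i1) i2,
    integral_add' (integrable_const _) i1, integral_add' i3 i4,
    integral_finsetSum _ fun i _ => i2' i,
    integral_finsetSum _ fun i _ => i3' _ ((hF i).inter (hB1 i)),
    integral_finsetSum _ fun i _ => i3' _ ((hD i).compl.inter (hB2 i)), Finset.mul_sum,
    Finset.mul_sum]
  refine add_le_add (add_le_add ?_ ?_) (add_le_add ?_ ?_)
  · rw [integral_const, probReal_univ, one_smul,
      integral_finsetSum _ fun i _ => integrable_finsetSum _ fun k _ =>
        (integrable_segmentMisestimates env hcd i (j i) k).const_mul _, add_right_comm,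
      ← Finset.sum_add_distrib]
    gcongr with i hi
    refine le_trans ?_ (segmentConst_add_le_ucbConst i)
    rw [integral_finsetSum _ fun k _ =>
      (integrable_segmentMisestimates env hcd i (j i) k).const_mul _]
    gcongr with k hk
    rw [integral_const_mul]
    exact mul_le_mul_of_nonneg_left (integral_segmentMisestimates_le env hcd
      (Finset.mem_Icc.1 hi).1 (Finset.mem_Icc.1 hi).2 _ _) (gap_nonneg i k)
  · exact Finset.sum_le_sum fun i _ => integral_indicator_le_cond (hS i) fun ω => delay_nonneg
  · exact Finset.sum_le_sum fun i _ => hpen _ _ (hF i) (hB1 i)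
  · exact Finset.sum_le_sum fun i _ => hpen _ _ (hD i).compl (hB2 i)

end Expectation

end DimExp

theorem theorem1 {Ω Ξ : Type*} [MeasurableSpace Ω] [MeasurableSpace Ξ]
    (P : Measure Ω) [IsProbabilityMeasure P]
    (K : ℕ) [NeZero K] (T : ℕ) (hT : 1 ≤ T)
    -- the environment: independent reward vectors with values in `[0, 1]`
    (f : ℕ → Fin K → Measure ℝ) (X : ℕ → Fin K → Ω → ℝ)
    (hX : ∀ t ∈ Finset.Icc 1 T, ∀ k, Measurable (X t k))
    (hlaw : ∀ t ∈ Finset.Icc 1 T, ∀ k, P.map (X t k) = f t k)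
    (hbdd : ∀ t ∈ Finset.Icc 1 T, ∀ k, ∀ᵐ x ∂(f t k), x ∈ Set.Icc (0 : ℝ) 1)
    (hindep : iIndepFun (fun (t : Finset.Icc 1 T) (ω : Ω) (k : Fin K) => X t k ω) P)
    -- the internal randomization of the detector (constant for a deterministic detector)
    (ξ : Ω → Ξ) (hξ : Measurable ξ)
    (hξX : IndepFun ξ (fun (ω : Ω) (t : Finset.Icc 1 T) (k : Fin K) => X t k ω) P)
    -- the algorithm, with an arbitrary tie-breaking rule and an arbitrary change detector
    (c : Config K Ξ) (hα : 0 < c.α)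
    (hrestart : c.restart = 1 ∨ c.restart = firstStart K c.α)
    (htie : ∀ S : Finset (Fin K), S.Nonempty → c.tie S ∈ S)
    (hcd : ∀ t τ : ℕ, MeasurableSet
      {p : Ξ × (ℕ → Fin K) × (ℕ → ℝ) | c.cd p.1 t τ p.2.1 p.2.2})
    -- the delays allowed in the detection events
    (h : ℕ → ℕ) :
    let M : ℕ := numSegments f T
    let ν : ℕ → ℕ := changeTime f T
    let τ : ℕ → Ω → ℕ∞ := alarm X ξ c T
    let F : ℕ → Set Ω := falseAlarm f X ξ c T
    let D : ℕ → Set Ω := detected f X ξ c T h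
    regret P X ξ c T ≤
      ∑ i ∈ Finset.Icc 1 M, ucbConst f T i
      + 2 * c.α * Real.sqrt (M * T)
      + ∑ i ∈ Finset.Icc 1 (M - 1),
          ∫ ω, (((τ i ω).toNat : ℝ) - (ν i : ℝ))
            ∂(P[|D i ∩ (F i)ᶜ ∩ D (i - 1) ∩ (F (i - 1))ᶜ])
      + (T * ∑ i ∈ Finset.Icc 1 M, (P[|(F (i - 1))ᶜ ∩ D (i - 1)]).real (F i)
        + T * ∑ i ∈ Finset.Icc 1 (M - 1),
            (P[|(F i)ᶜ ∩ (F (i - 1))ᶜ ∩ D (i - 1)]).real (D i)ᶜ) := by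
  classical
  -- Rewards outside the horizon need not be measurable. Setting them to 0 makes the whole outcome
  -- measurable and changes neither the regret nor the alarms.
  let Y : ℕ → Fin K → Ω → ℝ := fun t => if t ∈ Finset.Icc 1 T then X t else 0
  have hXY : ∀ t ∈ Finset.Icc 1 T, X t = Y t := fun t ht => (if_pos ht).symm
  have hfun : (fun (t : Finset.Icc 1 T) (ω : Ω) (k : Fin K) => X t k ω)
      = fun (t : Finset.Icc 1 T) (ω : Ω) (k : Fin K) => Y t k ω := by
    funext t ω k
    rw [hXY t t.2]
  have hfun' : (fun (ω : Ω) (t : Finset.Icc 1 T) (k : Fin K) => X t k ω)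
      = fun (ω : Ω) (t : Finset.Icc 1 T) (k : Fin K) => Y t k ω := by
    funext ω t k
    rw [hXY t t.2]
  have env : IsEnvironment P f Y ξ T :=
    { measurable := fun t k => by
        by_cases ht : t ∈ Finset.Icc 1 T
        · rw [← hXY t ht]
          exact hX t ht k
        · simp only [Y, if_neg ht]
          exact measurable_const
      law := fun t ht k => by rw [← hXY t ht]; exact hlaw t ht k
      bounded := hbdd
      indep := by rw [← hfun]; exact hindep
      measurable_randomization := hξ
      indep_randomization := by rw [← hfun']; exact hξX }
  have halarm := alarm_congr hXY ξ c
  have hF : falseAlarm f X ξ c T = falseAlarm f Y ξ c T := by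
    funext i
    simp only [falseAlarm, halarm]
  have hD : detected f X ξ c T h = detected f Y ξ c T h := by
    funext i
    simp only [detected, halarm]
  intro M ν τ F D
  have hbound := regret_le env hcd hα htie h
  simp only [successPair] at hbound
  rw [← regret_congr hXY ξ c P, ← halarm, ← hF, ← hD] at hbound
  exact hbound
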